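/- Let $b\ge 1$. A $b$-ball juggling state is a sequence $\alpha=\langle\alpha_1,\alpha_2,\dots\rangle$ of non-negative integers with $\sum_{i\ge1}\alpha_i=b$. There is a transition $\alpha\to\beta$ between two such states if and only if $\alpha_{i+1}\le\beta_i$ for all $i\ge 1$. A prime juggling pattern of period $n$ is a closed walk of length $n$ in the resulting directed graph that visits $n$ distinct states, where closed walks that differ only by a rotation (the choice of the starting state) are identified. Let $\mathcal M'(2,n)$ be the set of 2-ball multiplex prime patterns of period $n$, that is, the prime patterns of period $n$ all of whose states have $b=2$ and entries in $\{0,1,2\}$. Let $\mathcal N'(2,n)\subseteq\mathcal M'(2,n)$ be the set of normal prime patterns, those in which all states have entries in $\{0,1\}$. The elements of $\mathcal M'(2,n)\setminus\mathcal N'(2,n)$ are called strict multiplex prime patterns. For $t\ge1$ and $n\ge1$ put $$c_t(n)=\sum_{\substack{p_1>\cdots>p_t\ge1\\ p_1+\cdots+p_t=n}}\frac{1}{t(t+1)}\prod_{i=1}^t\left(\frac{i+1}{i}\right)^{p_i}.$$ **Theorem.** For every $n\ge1$ the sets $\mathcal M'(2,n)\setminus\mathcal N'(2,n)$ and $\mathcal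 M'(2,n)$ are finite, the sums over $t$ below have only finitely many non-zero terms, and $$\bigl|\mathcal M'(2,n)\setminus\mathcal N'(2,n)\bigr|=\sum_{t\ge1}\left(\sum_{m=1}^{n-1}t\,c_t(m)\right)+1,$$ $$\bigl|\mathcal M'(2,n)\bigr|=\sum_{t\ge1}\left(c_t(n)+\sum_{m=1}^{n-1}t\,c_t(m)\right)+1.$$ -/

import Mathlib

/-- A juggling state `⟨α₁, α₂, …⟩` with `b` balls: a sequence of natural numbers with sum `b`.
The value at index `i : ℕ` is the entry `α_{i+1}`, i.e. the number of balls that are scheduled to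
land in `i + 1` beats. -/
def JugglingState (b : ℕ) : Type :=
  {α : ℕ →₀ ℕ // (α.sum fun _ a => a) = b}

/-- `α → β` is a legal transition in one beat iff `α_{i+1} ≤ β_i` for every position `i`
(both states have the same number of balls by their type). -/
def JugglingState.Step {b : ℕ} (α β : JugglingState b) : Prop :=
  ∀ i : ℕ, α.1 (i + 1) ≤ β.1 i

/-- The state can be juggled with hand capacity `k`: all of its entries are at most `k`. -/
def JugglingState.HasCapacity {b : ℕ} (k : ℕ) (α : JugglingState b) : Prop :=
  ∀ i : ℕ, α.1 i ≤ k

/-- The set of prime `b`-ball juggling patterns of period `n` with hand capacity `k`: closed walks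
of length `n` in the state graph that visit `n` distinct states. The starting point of the walk is
immaterial, so a pattern is a `Cycle` (a list of states up to rotation); `Cycle.Chain` demands a
transition between consecutive states, and from the last state back to the first. -/
def multiplexPrime (b n k : ℕ) : Set (Cycle (JugglingState b)) :=
  {ρ | ρ.length = n ∧ ρ.Nodup ∧ ρ.Chain JugglingState.Step ∧ ∀ α ∈ ρ, α.HasCapacity k}

/-- The set of normal prime `b`-ball juggling patterns of period `n`: all entries of all states
are `0` or `1`. -/
def normalPrime (b n : ℕ) : Set (Cycle (JugglingState b)) :=
  multiplexPrime b n 1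

/-- The set of strict 2-ball multiplex prime patterns of period `n`: the 2-ball multiplex prime
patterns (capacity `2`) that are not normal prime patterns. -/
def strictMultiplexPrime (n : ℕ) : Set (Cycle (JugglingState 2)) :=
  multiplexPrime 2 n 2 \ normalPrime 2 n

/-- The number `c_t(n)`, the sum over all `p₁ > ⋯ > p_t ≥ 1` with `p₁ + ⋯ + p_t = n` of
`1 / (t (t + 1)) * ∏_{i=1}^t ((i + 1) / i) ^ {p_i}`. The entry `p_{i+1}` is `p i` for `i : Fin t`. -/
def spacingCount (t n : ℕ) : ℚ :=
  ∑ p ∈ (Finset.finAntidiagonal t n).filter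
      (fun p : Fin t → ℕ => (∀ i j, i < j → p j < p i) ∧ ∀ i, 1 ≤ p i),
    1 / ((t : ℚ) * ((t : ℚ) + 1)) *
      ∏ i : Fin t, ((((i : ℕ) : ℚ) + 2) / (((i : ℕ) : ℚ) + 1)) ^ p i

/-!
A state with two balls is determined by the pair `(a, e)` of the height `a` of the lower ball and
the distance `e` between the balls. States with `a > 0` have a single successor, `(a - 1, e)`, so a
pattern is determined by the sequence of states `(0, e)` it meets, its *vertices*, together with the
number of beats between consecutive vertices (`exists_unfoldEdges_eq`, `unfoldEdges_inj`). From the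
vertex `d ≥ 1` one reaches every `e` in `d` beats, and every `e` with `1 ≤ e < d` also in `d - e`
beats; from the vertex `0` one reaches every `e` in any positive number of beats. A pattern is prime
iff its vertices are distinct, and it is normal iff it avoids the vertex `0`.

Call an edge of length `d - e` short and one of length `d` full. Cutting a walk after its full edges
leaves chains `a₁ > a₂ > ⋯ > a_j` traversed by short edges, and the lengths
`(a₁ - a₂) + ⋯ + (a_{j-1} - a_j) + a_j` telescope to `a₁`. So a closed walk through distinct
vertices is a list of disjoint decreasing chains of positive integers, a *code*, whose length is the
sum of the tops of the chains. Normal patterns of period `n` correspond to codes with top sum `n`, up to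
rotation of the list of chains, which is fixed by starting at the largest vertex
(`image_normalPattern`). Patterns through the vertex `0` correspond to a number `l ≥ 1` of beats
from `0` to the first vertex and a linear list of chains with top sum `n - l`
(`image_strictPattern`); the empty code gives the loop at `0`, the summand `1` of the formulas.

It remains to count codes. Let the tops be `q₁ > ⋯ > q_t`, in any order along the list. Every other
`k` is in no chain or in one of the chains with a larger top, so there are
`W(q) = ∏_{k ∉ q} (1 + #{i | k < qᵢ})` choices (`card_filter_sup_eq`). The linear orders of the
tops give the factor `t!`, those with the largest one first the factor `(t - 1)!`. The tops
contribute `∏ (1 + #{j | qᵢ < qⱼ}) = t!` to the full product over `k`, so `t! W(q)` is the product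
over all `k`; writing `1 + #{i | k < qᵢ}` as the telescoping product of `(i + 1) / i` over these
`i` and exchanging the products gives `t! W(q) = (t + 1)⁻¹ ∏ ((i + 1) / i) ^ qᵢ`
(`factorial_mul_blockWeight_eq`). Hence there are `t c_t(m)` codes with `t` chains and top sum `m`,
of which `c_t(m)` start with their largest entry.
-/

/-! ### Two-ball states as pairs -/

/-- The two-ball state with balls at heights `a` and `a + e` (indices counted from `0`), for the
pair `(a, e)`. -/
noncomputable def pairState (s : ℕ × ℕ) : JugglingState 2 :=
  ⟨Finsupp.single s.1 1 + Finsupp.single (s.1 + s.2) 1, by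
    rw [Finsupp.sum_add_index' (fun _ => rfl) (fun _ _ _ => rfl)]
    simp⟩

theorem pairState_apply (s : ℕ × ℕ) (i : ℕ) :
    (pairState s).1 i = (if s.1 = i then 1 else 0) + (if s.1 + s.2 = i then 1 else 0) := by
  simp [pairState, Finsupp.single_apply]

theorem pairState_bijective : Function.Bijective pairState := by
  constructor
  · rintro ⟨a, e⟩ ⟨b, f⟩ h
    have key : ∀ i, (pairState (a, e)).1 i = (pairState (b, f)).1 i := fun i => by rw [h]
    simp only [pairState_apply] at key
    have h1 := key a
    have h2 := key b
    have h3 := key (a + e)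
    have h4 := key (b + f)
    ext <;> grind
  · rintro ⟨α, hα⟩
    have hc : (Finsupp.toMultiset α).card = 2 := by
      rw [Finsupp.card_toMultiset]; exact hα
    obtain ⟨x, y, hxy⟩ := Multiset.card_eq_two.1 hc
    wlog hle : x ≤ y generalizing x y
    · exact this y x (by rw [hxy, Multiset.pair_comm]) (by omega)
    refine ⟨(x, y - x), Subtype.ext ?_⟩
    apply Multiset.toFinsupp.symm.injective
    change Finsupp.toMultiset _ = Finsupp.toMultiset _
    rw [hxy]
    simp [pairState, Nat.add_sub_cancel' hle, Finsupp.toMultiset_single]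

/-- The transition relation of two-ball states, read off on pairs: a state without a ball at
height `0` drops by one, and from `(0, e)` one ball is thrown freely, two balls if `e = 0`. -/
def PairStep (s t : ℕ × ℕ) : Prop :=
  (s.1 = t.1 + 1 ∧ s.2 = t.2) ∨
    (s.1 = 0 ∧ (s.2 = 0 ∨ t.1 + 1 = s.2 ∨ t.1 + 1 + t.2 = s.2))

theorem step_pairState (s t : ℕ × ℕ) : (pairState s).Step (pairState t) ↔ PairStep s t := by
  obtain ⟨a, e⟩ := s
  obtain ⟨b, f⟩ := t
  simp only [JugglingState.Step, pairState_apply, PairStep]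
  constructor
  · intro h
    have h1 := h (a - 1)
    have h2 := h (a + e - 1)
    grind
  · intro h i
    grind

theorem hasCapacity_two_pairState (s : ℕ × ℕ) : (pairState s).HasCapacity 2 := by
  intro i
  rw [pairState_apply]
  split_ifs <;> omega

theorem hasCapacity_one_pairState (s : ℕ × ℕ) : (pairState s).HasCapacity 1 ↔ s.2 ≠ 0 := by
  simp only [JugglingState.HasCapacity, pairState_apply]
  constructor
  · intro h
    have := h s.1
    grind
  · intro h i
    grind

/-- The prime two-ball patterns of period `n`, with states written as pairs. -/
def pairPrime (n : ℕ) : Set (Cycle (ℕ × ℕ)) :=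
  {ρ | ρ.length = n ∧ ρ.Nodup ∧ ρ.Chain PairStep}

theorem cycleMap_injective {α β : Type*} {f : α → β} (hf : f.Injective) :
    (Cycle.map f).Injective := by
  intro x y
  induction x, y using Quotient.inductionOn₂ with
  | _ l m =>
    intro h
    have h' : (l.map f) ~r (m.map f) := Quotient.exact h
    obtain ⟨k, hk⟩ := h'
    rw [← List.map_rotate] at hk
    exact Quotient.sound ⟨k, List.map_injective_iff.2 hf hk⟩

theorem cycleMap_surjective {α β : Type*} {f : α → β} (hf : f.Surjective) :
    (Cycle.map f).Surjective := by
  intro x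
  induction x using Quotient.inductionOn with
  | _ l =>
    obtain ⟨m, rfl⟩ := List.map_surjective_iff.2 hf l
    exact ⟨(m : Cycle α), rfl⟩

theorem map_pairState_mem_multiplexPrime (n : ℕ) (ρ : Cycle (ℕ × ℕ)) :
    ρ.map pairState ∈ multiplexPrime 2 n 2 ↔ ρ ∈ pairPrime n := by
  have h1 : (ρ.map pairState).length = ρ.length := by
    induction ρ using Quotient.inductionOn with | _ l => exact List.length_map _
  have h2 : (ρ.map pairState).Nodup ↔ ρ.Nodup := by
    induction ρ using Quotient.inductionOn with
    | _ l => exact List.nodup_map_iff pairState_bijective.1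
  have h4 : ∀ α ∈ ρ.map pairState, α.HasCapacity 2 := by
    intro α _
    obtain ⟨s, rfl⟩ := pairState_bijective.2 α
    exact hasCapacity_two_pairState s
  simp only [multiplexPrime, pairPrime, Set.mem_ofPred_eq, h1, h2, Cycle.chain_map,
    step_pairState]
  tauto

theorem multiplexPrime_two_eq_image (n : ℕ) :
    multiplexPrime 2 n 2 = Cycle.map pairState '' pairPrime n := by
  ext σ
  obtain ⟨ρ, rfl⟩ := cycleMap_surjective pairState_bijective.2 σ
  rw [map_pairState_mem_multiplexPrime,
    (cycleMap_injective pairState_bijective.1).mem_set_image]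

theorem normalPrime_two_eq_image (n : ℕ) :
    normalPrime 2 n = Cycle.map pairState '' {ρ ∈ pairPrime n | ∀ s ∈ ρ, s.2 ≠ 0} := by
  ext σ
  obtain ⟨ρ, rfl⟩ := cycleMap_surjective pairState_bijective.2 σ
  rw [(cycleMap_injective pairState_bijective.1).mem_set_image]
  have h : (∀ α ∈ ρ.map pairState, α.HasCapacity 1) ↔ ∀ s ∈ ρ, s.2 ≠ 0 := by
    simp only [Cycle.mem_map, forall_exists_index, and_imp, forall_apply_eq_imp_iff₂,
      hasCapacity_one_pairState]
  have h2 := map_pairState_mem_multiplexPrime n ρ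
  have h4 : ∀ α ∈ ρ.map pairState, α.HasCapacity 2 := by
    intro α _
    obtain ⟨s, rfl⟩ := pairState_bijective.2 α
    exact hasCapacity_two_pairState s
  simp only [normalPrime, multiplexPrime, Set.mem_ofPred_eq, h] at h2 ⊢
  tauto

/-! ### Edges and codes -/

/-- The `l` consecutive states `(l - 1, e), …, (0, e)`. -/
def ramp : ℕ → ℕ → List (ℕ × ℕ)
  | 0, _ => []
  | l + 1, e => (l, e) :: ramp l e

theorem mem_ramp {l e : ℕ} {s : ℕ × ℕ} : s ∈ ramp l e ↔ s.1 < l ∧ s.2 = e := by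
  induction l with
  | zero => simp [ramp]
  | succ l ih =>
    obtain ⟨a, b⟩ := s
    simp only [ramp, List.mem_cons, ih, Prod.mk.injEq]
    omega

theorem length_ramp (l e : ℕ) : (ramp l e).length = l := by
  induction l with
  | zero => rfl
  | succ l ih => simp [ramp, ih]

theorem nodup_ramp (l e : ℕ) : (ramp l e).Nodup := by
  induction l with
  | zero => simp [ramp]
  | succ l ih => simp [ramp, ih, mem_ramp]

theorem exists_ramp_eq_concat (l e : ℕ) : ∃ M, ramp (l + 1) e = M ++ [(0, e)] := by
  induction l with
  | zero => exact ⟨[], rfl⟩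
  | succ l ih =>
    obtain ⟨M, hM⟩ := ih
    exact ⟨(l + 1, e) :: M, by rw [ramp, hM]; rfl⟩

/-- The walk through the states of a list of edges, where the edge `(l, e)` stands for the `l`
states leading to `(0, e)`. -/
def unfoldEdges (Q : List (ℕ × ℕ)) : List (ℕ × ℕ) :=
  Q.flatMap fun q => ramp q.1 q.2

theorem unfoldEdges_cons (q : ℕ × ℕ) (Q : List (ℕ × ℕ)) :
    unfoldEdges (q :: Q) = ramp q.1 q.2 ++ unfoldEdges Q := rfl

theorem length_unfoldEdges (Q : List (ℕ × ℕ)) :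
    (unfoldEdges Q).length = (Q.map Prod.fst).sum := by
  simp [unfoldEdges, List.length_flatMap, length_ramp]

/-- The edge `r` may follow the edge `q`: from `(0, d)` with `d ≠ 0`, the other ball is thrown
above or below the ball that lands next, so that `(0, e)` is reached after `d` or `d - e` beats;
from `(0, 0)` it is reached after any positive number of beats. -/
def EdgeRel (q r : ℕ × ℕ) : Prop :=
  1 ≤ r.1 ∧ (q.2 = 0 ∨ r.1 = q.2 ∨ r.1 + r.2 = q.2)

theorem one_le_fst_of_isChain {q : ℕ × ℕ} {Q : List (ℕ × ℕ)}
    (h : List.IsChain EdgeRel (q :: Q)) : ∀ r ∈ Q, 1 ≤ r.1 := by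
  induction Q generalizing q with
  | nil => simp
  | cons r Q ih =>
    rw [List.isChain_cons_cons] at h
    intro s hs
    rcases List.mem_cons.1 hs with rfl | hs
    · exact h.1.1
    · exact ih h.2 s hs

/-- A walk that ends with a ball at height `0` runs down the current ramp and then follows edges.
The length `l` of the edge into the starting vertex plays no role. -/
theorem exists_unfoldEdges_eq {L : List (ℕ × ℕ)} {s : ℕ × ℕ} (l : ℕ)
    (h : List.IsChain PairStep (s :: L)) (hl : ((s :: L).getLast (by simp)).1 = 0) :
    ∃ Q, L = ramp s.1 s.2 ++ unfoldEdges Q ∧ List.IsChain EdgeRel ((l, s.2) :: Q) := by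
  induction L generalizing s l with
  | nil =>
    refine ⟨[], ?_, by simp⟩
    have : s.1 = 0 := by simpa using hl
    simp [this, ramp, unfoldEdges]
  | cons t L ih =>
    rw [List.isChain_cons_cons] at h
    rw [List.getLast_cons (by simp)] at hl
    obtain ⟨⟨h1, h2⟩ | ⟨h1, h2⟩, h3⟩ := h
    · obtain ⟨Q, hQ, hc⟩ := ih l h3 hl
      refine ⟨Q, ?_, h2 ▸ hc⟩
      rw [h1, h2, hQ]
      rfl
    · obtain ⟨Q, hQ, hc⟩ := ih (t.1 + 1) h3 hl
      refine ⟨(t.1 + 1, t.2) :: Q, ?_, ?_⟩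
      · rw [h1, unfoldEdges_cons, hQ]
        rfl
      · rw [List.isChain_cons_cons]
        exact ⟨⟨by simp, h2.imp id (Or.imp id id)⟩, hc⟩

theorem isChain_unfoldEdges {Q : List (ℕ × ℕ)} {q : ℕ × ℕ} (a : ℕ)
    (h : List.IsChain EdgeRel (q :: Q)) :
    List.IsChain PairStep ((a, q.2) :: (ramp a q.2 ++ unfoldEdges Q)) := by
  induction Q generalizing q a with
  | nil =>
    induction a with
    | zero => simp [ramp, unfoldEdges]
    | succ a ih =>
      rw [ramp, List.cons_append, List.isChain_cons_cons]
      exact ⟨Or.inl ⟨rfl, rfl⟩, ih⟩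
  | cons r Q ih =>
    induction a with
    | zero =>
      rw [List.isChain_cons_cons] at h
      obtain ⟨⟨h1, h2⟩, h3⟩ := h
      obtain ⟨l, e⟩ := r
      obtain ⟨l, rfl⟩ : ∃ k, l = k + 1 := ⟨l - 1, by simp at h1; omega⟩
      rw [unfoldEdges_cons]
      simp only [ramp, List.nil_append, List.cons_append]
      rw [List.isChain_cons_cons]
      exact ⟨Or.inr ⟨rfl, h2⟩, ih l h3⟩
    | succ a ih' =>
      rw [ramp, List.cons_append, List.isChain_cons_cons]
      exact ⟨Or.inl ⟨rfl, rfl⟩, ih'⟩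

theorem nodup_unfoldEdges {Q : List (ℕ × ℕ)} (hQ : ∀ q ∈ Q, 1 ≤ q.1) :
    (unfoldEdges Q).Nodup ↔ (Q.map Prod.snd).Nodup := by
  rw [unfoldEdges, List.nodup_flatMap, List.nodup_iff_pairwise_ne (l := Q.map Prod.snd),
    List.pairwise_map]
  constructor
  · rintro ⟨-, h⟩
    refine h.imp_of_mem fun {q r} hq hr hd he => ?_
    refine hd (a := (0, q.2)) ?_ ?_
    · exact mem_ramp.2 ⟨hQ q hq, rfl⟩
    · exact mem_ramp.2 ⟨hQ r hr, he⟩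
  · intro h
    refine ⟨fun q _ => nodup_ramp _ _, h.imp fun {q r} hne s hs ht => hne ?_⟩
    rw [← (mem_ramp.1 hs).2, (mem_ramp.1 ht).2]

theorem unfoldEdges_inj {Q Q' : List (ℕ × ℕ)} (hQ : ∀ q ∈ Q, 1 ≤ q.1) (hQ' : ∀ q ∈ Q', 1 ≤ q.1)
    (h : unfoldEdges Q = unfoldEdges Q') : Q = Q' := by
  have key : ∀ (l e : ℕ) (R : List (ℕ × ℕ)), 1 ≤ l →
      ∃ S, ramp l e ++ R = (l - 1, e) :: S := by
    intro l e R hl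
    obtain ⟨l, rfl⟩ : ∃ k, l = k + 1 := ⟨l - 1, by omega⟩
    exact ⟨ramp l e ++ R, rfl⟩
  induction Q generalizing Q' with
  | nil =>
    cases Q' with
    | nil => rfl
    | cons r Q' =>
      obtain ⟨S, hS⟩ := key r.1 r.2 (unfoldEdges Q') (hQ' r (by simp))
      rw [unfoldEdges_cons, hS] at h
      simp [unfoldEdges] at h
  | cons q Q ih =>
    have hq := hQ q (by simp)
    cases Q' with
    | nil =>
      obtain ⟨S, hS⟩ := key q.1 q.2 (unfoldEdges Q) hq
      rw [unfoldEdges_cons, hS] at h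
      simp [unfoldEdges] at h
    | cons r Q' =>
      have hr := hQ' r (by simp)
      obtain ⟨S, hS⟩ := key q.1 q.2 (unfoldEdges Q) hq
      obtain ⟨T, hT⟩ := key r.1 r.2 (unfoldEdges Q') hr
      have h0 := h
      rw [unfoldEdges_cons, hS, unfoldEdges_cons, hT, List.cons.injEq, Prod.mk.injEq] at h0
      have hqr : q = r := Prod.ext (by omega) h0.1.2
      subst hqr
      rw [unfoldEdges_cons, unfoldEdges_cons, List.append_cancel_left_eq] at h
      rw [ih (fun x hx => hQ x (by simp [hx])) (fun x hx => hQ' x (by simp [hx])) h]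

/-- The edges through the vertices of a chain `c`, entered by an edge of length `l` and followed
along short edges. -/
def chainEdges : ℕ → List ℕ → List (ℕ × ℕ)
  | _, [] => []
  | l, a :: c => (l, a) :: chainEdges (a - c.headD 0) c

/-- The edges of the walk that runs through the chains of `C` one after the other and ends at the
vertex `z`. The first edge has length `l`, each chain is left by a full-length edge. -/
def codeEdges (z : ℕ) : ℕ → List (List ℕ) → List (ℕ × ℕ)
  | l, [] => [(l, z)]
  | l, c :: C => chainEdges l c ++ codeEdges z (c.getLastD 0) C

/-- A code: a list of nonempty decreasing chains of positive integers, with no integer used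
twice. -/
structure IsCode (C : List (List ℕ)) : Prop where
  ne_nil : ∀ c ∈ C, c ≠ []
  isChain : ∀ c ∈ C, c.IsChain (· > ·)
  nodup : C.flatten.Nodup
  zero_notMem : 0 ∉ C.flatten

/-- The sum of the largest entries of the chains of a code. -/
def topSum (C : List (List ℕ)) : ℕ :=
  (C.map fun c => c.headD 0).sum

theorem IsCode.tail {c : List ℕ} {C : List (List ℕ)} (h : IsCode (c :: C)) : IsCode C where
  ne_nil x hx := h.ne_nil x (by simp [hx])
  isChain x hx := h.isChain x (by simp [hx])
  nodup := by
    have := h.nodup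
    rw [List.flatten_cons] at this
    exact this.of_append_right
  zero_notMem := by
    have := h.zero_notMem
    simp only [List.flatten_cons, List.mem_append, not_or] at this
    exact this.2

theorem map_snd_chainEdges (l : ℕ) (c : List ℕ) : (chainEdges l c).map Prod.snd = c := by
  induction c generalizing l with
  | nil => rfl
  | cons a c ih => simp [chainEdges, ih]

theorem map_snd_codeEdges (z l : ℕ) (C : List (List ℕ)) :
    (codeEdges z l C).map Prod.snd = C.flatten ++ [z] := by
  induction C generalizing l with
  | nil => rfl
  | cons c C ih => simp [codeEdges, ih, map_snd_chainEdges]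

theorem sum_fst_chainEdges (l a : ℕ) (c : List ℕ) (h : (a :: c).IsChain (· > ·)) :
    ((chainEdges l (a :: c)).map Prod.fst).sum + (a :: c).getLastD 0 = l + a := by
  induction c generalizing l a with
  | nil => simp [chainEdges]
  | cons b c ih =>
    rw [List.isChain_cons_cons] at h
    have := ih (a - b) b h.2
    simp only [chainEdges, List.map_cons, List.sum_cons, List.headD_cons,
      List.getLastD_cons] at this ⊢
    omega

/-- The edge lengths telescope along each chain, short edges and closing full edge together
contributing the top of the chain. -/
theorem sum_fst_codeEdges (z l : ℕ) {C : List (List ℕ)} (h : IsCode C) :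
    ((codeEdges z l C).map Prod.fst).sum = l + topSum C := by
  induction C generalizing l with
  | nil => simp [codeEdges, topSum]
  | cons c C ih =>
    have hc := h.ne_nil c (by simp)
    cases c with
    | nil => exact absurd rfl hc
    | cons a c =>
      have h1 := sum_fst_chainEdges l a c (h.isChain _ (by simp))
      have h2 := ih ((a :: c).getLastD 0) h.tail
      rw [codeEdges, List.map_append, List.sum_append, h2]
      simp only [topSum, List.map_cons, List.sum_cons, List.headD_cons] at h1 ⊢
      omega

theorem isChain_chainEdges_append (l a : ℕ) (c : List ℕ) (R : List (ℕ × ℕ))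
    (h : (a :: c).IsChain (· > ·))
    (hR : ∀ k, List.IsChain EdgeRel ((k, (a :: c).getLastD 0) :: R)) :
    List.IsChain EdgeRel (chainEdges l (a :: c) ++ R) := by
  induction c generalizing l a with
  | nil => exact hR l
  | cons b c ih =>
    rw [List.isChain_cons_cons] at h
    have := ih (a - b) b h.2 hR
    simp only [chainEdges, List.headD_cons, List.cons_append] at this ⊢
    rw [List.isChain_cons_cons]
    exact ⟨⟨by simp; omega, Or.inr (Or.inr (by simp; omega))⟩, this⟩

theorem isChain_codeEdges (z k d : ℕ) (hd : 1 ≤ d) {C : List (List ℕ)} (h : IsCode C) :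
    List.IsChain EdgeRel ((k, d) :: codeEdges z d C) := by
  induction C generalizing k d with
  | nil => simp [codeEdges, EdgeRel, hd]
  | cons c C ih =>
    have hc := h.ne_nil c (by simp)
    cases c with
    | nil => exact absurd rfl hc
    | cons a c =>
      have := isChain_chainEdges_append d a c (codeEdges z ((a :: c).getLastD 0) C)
        (h.isChain _ (by simp)) (fun k => ih k _ ?_ h.tail)
      · rw [codeEdges]
        simp only [chainEdges, List.cons_append] at this ⊢
        rw [List.isChain_cons_cons]
        exact ⟨⟨hd, Or.inr (Or.inl rfl)⟩, this⟩
      · have h0 := h.zero_notMem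
        simp only [List.flatten_cons, List.mem_append, not_or] at h0
        have hm : (a :: c).getLastD 0 ∈ a :: c := by
          rw [List.getLastD_eq_getLast?, List.getLast?_eq_getLast_of_ne_nil (by simp)]
          exact List.getLast_mem _
        by_contra hlt
        have : (a :: c).getLastD 0 = 0 := by omega
        exact h0.1 (this ▸ hm)

theorem exists_codeEdges_eq_cons (z l : ℕ) {C : List (List ℕ)} (h : ∀ c ∈ C, c ≠ []) :
    ∃ x R, codeEdges z l C = (l, x) :: R := by
  cases C with
  | nil => exact ⟨z, [], rfl⟩
  | cons c C =>
    cases c with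
    | nil => exact absurd rfl (h [] (by simp))
    | cons a c => exact ⟨a, _, rfl⟩

theorem chainEdges_append_codeEdges_inj (z l a : ℕ) {c c' : List ℕ} {C C' : List (List ℕ)}
    (hC : ∀ x ∈ C, x ≠ []) (hC' : ∀ x ∈ C', x ≠ []) (ha : a ≠ 0) (hc : 0 ∉ c) (hc' : 0 ∉ c')
    (ih : ∀ k, codeEdges z k C = codeEdges z k C' → C = C')
    (h : codeEdges z l ((a :: c) :: C) = codeEdges z l ((a :: c') :: C')) :
    c = c' ∧ C = C' := by
  induction c generalizing l a c' with
  | nil =>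
    cases c' with
    | nil => exact ⟨rfl, ih a (by simpa [codeEdges, chainEdges] using h)⟩
    | cons b c' =>
      obtain ⟨x, R, hx⟩ := exists_codeEdges_eq_cons z a hC
      simp only [codeEdges, chainEdges, List.headD_cons, List.cons_append, List.nil_append,
        List.getLastD_cons, List.getLastD_nil, hx, List.cons.injEq, Prod.mk.injEq] at h
      simp at hc'
      omega
  | cons b c ihc =>
    cases c' with
    | nil =>
      obtain ⟨x, R, hx⟩ := exists_codeEdges_eq_cons z a hC'
      simp only [codeEdges, chainEdges, List.headD_cons, List.cons_append, List.nil_append,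
        List.getLastD_cons, List.getLastD_nil, hx, List.cons.injEq, Prod.mk.injEq] at h
      simp at hc
      omega
    | cons b' c' =>
      have h0 := h
      simp only [codeEdges, chainEdges, List.headD_cons, List.cons_append,
        List.cons.injEq, Prod.mk.injEq] at h0
      obtain rfl : b = b' := h0.2.1.2
      simp only [List.mem_cons, not_or] at hc hc'
      have := ihc (a - b) b (fun h => hc.1 h.symm) hc.2 hc'.2 (by
        rw [codeEdges, codeEdges] at h ⊢
        simpa [chainEdges] using h)
      exact ⟨by rw [this.1], this.2⟩

/-- A code can be read off from its edges: a full edge out of `a` has length `a`, a short one is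
shorter since its endpoint is positive. -/
theorem codeEdges_inj {z l l' : ℕ} {C C' : List (List ℕ)} (hC : IsCode C) (hC' : IsCode C')
    (h : codeEdges z l C = codeEdges z l' C') : l = l' ∧ C = C' := by
  have hl : l = l' := by
    obtain ⟨x, R, hx⟩ := exists_codeEdges_eq_cons z l hC.ne_nil
    obtain ⟨y, S, hy⟩ := exists_codeEdges_eq_cons z l' hC'.ne_nil
    rw [hx, hy, List.cons.injEq, Prod.mk.injEq] at h
    exact h.1.1
  subst hl
  refine ⟨rfl, ?_⟩
  have hf : C.flatten = C'.flatten := by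
    have := congrArg (List.map Prod.snd) h
    rw [map_snd_codeEdges, map_snd_codeEdges] at this
    exact List.append_cancel_right this
  induction C generalizing l C' with
  | nil =>
    cases C' with
    | nil => rfl
    | cons c' C' => exact absurd (by simp at hf; exact hf.1) (hC'.ne_nil c' (by simp))
  | cons c C ih =>
    cases C' with
    | nil => exact absurd (by simp at hf; exact hf.1) (hC.ne_nil c (by simp))
    | cons c' C' =>
      have h1 := hC.ne_nil c (by simp)
      have h1' := hC'.ne_nil c' (by simp)
      cases c with
      | nil => exact absurd rfl h1
      | cons a c =>
        cases c' with
        | nil => exact absurd rfl h1'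
        | cons a' c' =>
          have h0 := hC.zero_notMem
          have h0' := hC'.zero_notMem
          obtain rfl : a = a' := by
            have := h
            simp only [codeEdges, chainEdges, List.cons_append, List.cons.injEq,
              Prod.mk.injEq] at this
            exact this.1.2
          simp only [List.flatten_cons, List.mem_append, List.mem_cons, not_or] at h0 h0'
          obtain ⟨rfl, rfl⟩ := chainEdges_append_codeEdges_inj z l a hC.tail.ne_nil
            hC'.tail.ne_nil (fun h => h0.1.1 h.symm) h0.1.2 h0'.1.2
            (fun k hk => ih hC.tail hC'.tail hk (by
              have := congrArg (List.map Prod.snd) hk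
              rw [map_snd_codeEdges, map_snd_codeEdges] at this
              exact List.append_cancel_right this)) h
          rfl

/-- Cutting a walk after its full-length edges writes it as a code. The condition on `z` ensures
that the last edge, into `z`, is a full-length one. -/
theorem exists_codeEdges_eq {z l d : ℕ} {Q : List (ℕ × ℕ)} {E : List ℕ}
    (h : List.IsChain EdgeRel ((l, d) :: Q)) (hE : Q.map Prod.snd = E ++ [z])
    (h0 : 0 ∉ d :: E) (hz : z = 0 ∨ ∀ x ∈ d :: E, x ≤ z) :
    ∃ c C, (l, d) :: Q = codeEdges z l ((d :: c) :: C) ∧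
      (∀ x ∈ (d :: c) :: C, x ≠ []) ∧ ∀ x ∈ (d :: c) :: C, x.IsChain (· > ·) := by
  induction E generalizing l d Q with
  | nil =>
    obtain ⟨⟨k, e⟩, rfl, he⟩ : ∃ q, Q = [q] ∧ q.2 = z := by
      obtain ⟨q, hq, he⟩ := List.map_eq_singleton_iff.1 hE
      exact ⟨q, hq, he⟩
    obtain rfl : e = z := he
    rw [List.isChain_cons_cons] at h
    obtain ⟨h1, h2 | h2 | h2⟩ := h.1
    · simp at h2 h0; omega
    · refine ⟨[], [], ?_, by simp, by simp⟩
      simp at h2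
      simp [codeEdges, chainEdges, h2]
    · -- a short edge into `z` starts above `z`, so `z = 0`, where short and full edges coincide
      simp at h1 h2 h0 hz
      refine ⟨[], [], ?_, by simp, by simp⟩
      have : k = d := by omega
      simp [codeEdges, chainEdges, this]
  | cons e E ih =>
    cases Q with
    | nil => simp at hE
    | cons q Q =>
      obtain ⟨k, e'⟩ := q
      simp only [List.map_cons, List.cons_append, List.cons.injEq] at hE
      obtain ⟨rfl, hE⟩ := hE
      rw [List.isChain_cons_cons] at h
      simp only [List.mem_cons, not_or] at h0
      obtain ⟨c, C, h3, h4, h5⟩ := ih h.2 hE (by simp [h0])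
        (hz.imp id fun hz x hx => hz x (List.mem_cons_of_mem _ hx))
      obtain ⟨h1, h2 | h2 | h2⟩ := h.1
      · exact absurd h2.symm h0.1
      · refine ⟨[], (e' :: c) :: C, ?_, ?_, ?_⟩
        · simp only at h2
          rw [h3, h2]
          simp [codeEdges, chainEdges]
        · intro x hx
          rcases List.mem_cons.1 hx with rfl | hx
          · simp
          · exact h4 x hx
        · intro x hx
          rcases List.mem_cons.1 hx with rfl | hx
          · simp
          · exact h5 x hx
      · simp only at h1 h2
        refine ⟨e' :: c, C, ?_, ?_, ?_⟩
        · rw [h3]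
          have : k = d - e' := by omega
          simp [codeEdges, chainEdges, this]
        · intro x hx
          rcases List.mem_cons.1 hx with rfl | hx
          · simp
          · exact h4 x (List.mem_cons_of_mem _ hx)
        · intro x hx
          rcases List.mem_cons.1 hx with rfl | hx
          · rw [List.isChain_cons_cons]
            exact ⟨by omega, h5 _ (by simp)⟩
          · exact h5 x (List.mem_cons_of_mem _ hx)

/-! ### Prime patterns and codes -/

/-- A walk of length `n` from `(0, z)` back to `(0, z)` through distinct states; `L` lists the
states after the starting point. -/
structure IsClosedWalk (z n : ℕ) (L : List (ℕ × ℕ)) : Prop where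
  length_eq : L.length = n
  nodup : L.Nodup
  isChain : List.IsChain PairStep ((0, z) :: L)
  eq_concat : ∃ M, L = M ++ [(0, z)]

theorem mem_unfoldEdges_zero {Q : List (ℕ × ℕ)} (hQ : ∀ q ∈ Q, 1 ≤ q.1) (e : ℕ) :
    (0, e) ∈ unfoldEdges Q ↔ e ∈ Q.map Prod.snd := by
  simp only [unfoldEdges, List.mem_flatMap, mem_ramp, List.mem_map]
  constructor
  · rintro ⟨q, hq, -, h⟩
    exact ⟨q, hq, h.symm⟩
  · rintro ⟨q, hq, h⟩
    exact ⟨q, hq, hQ q hq, h.symm⟩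

theorem IsClosedWalk.exists_edges {z n : ℕ} {L : List (ℕ × ℕ)} (h : IsClosedWalk z n L) :
    ∃ Q E, L = unfoldEdges Q ∧ List.IsChain EdgeRel ((0, z) :: Q) ∧
      Q.map Prod.snd = E ++ [z] ∧ (E ++ [z]).Nodup ∧ (Q.map Prod.fst).sum = n := by
  obtain ⟨M, hM⟩ := h.eq_concat
  obtain ⟨Q, hQ, hc⟩ := exists_unfoldEdges_eq 0 h.isChain (by simp [hM])
  simp only [ramp, List.nil_append] at hQ
  have hpos := one_le_fst_of_isChain hc
  have hsum := h.length_eq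
  rw [hQ, length_unfoldEdges] at hsum
  have hnd := h.nodup
  rw [hQ, nodup_unfoldEdges hpos] at hnd
  rcases List.eq_nil_or_concat Q with rfl | ⟨Q', ⟨l, e⟩, rfl⟩
  · simp [hM, unfoldEdges] at hQ
  · have hl := hpos (l, e) (by simp)
    obtain ⟨l, rfl⟩ : ∃ k, l = k + 1 := ⟨l - 1, by simp at hl; omega⟩
    obtain ⟨R, hR⟩ := exists_ramp_eq_concat l e
    have he : e = z := by
      have h2 := hQ
      rw [hM] at h2
      simp only [unfoldEdges, List.concat_eq_append, List.flatMap_append, List.flatMap_cons,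
        List.flatMap_nil, List.append_nil, hR] at h2
      rw [← List.append_assoc] at h2
      have := List.append_inj_right' h2 rfl
      simpa using this.symm
    subst he
    refine ⟨_, Q'.map Prod.snd, hQ, hc, by simp, ?_, hsum⟩
    simpa using hnd

theorem isClosedWalk_unfoldEdges {z n k : ℕ} {Q : List (ℕ × ℕ)} {E : List ℕ}
    (hc : List.IsChain EdgeRel ((k, z) :: Q)) (hE : Q.map Prod.snd = E ++ [z])
    (hnd : (E ++ [z]).Nodup) (hsum : (Q.map Prod.fst).sum = n) :
    IsClosedWalk z n (unfoldEdges Q) where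
  length_eq := by rw [length_unfoldEdges, hsum]
  nodup := by rwa [nodup_unfoldEdges (one_le_fst_of_isChain hc), hE]
  isChain := isChain_unfoldEdges 0 hc
  eq_concat := by
    have hpos := one_le_fst_of_isChain hc
    rcases List.eq_nil_or_concat Q with rfl | ⟨Q', ⟨l, e⟩, rfl⟩
    · simp at hE
    · have hl := hpos (l, e) (by simp)
      obtain ⟨l, rfl⟩ : ∃ k, l = k + 1 := ⟨l - 1, by simp at hl; omega⟩
      obtain ⟨R, hR⟩ := exists_ramp_eq_concat l e
      have he : e = z := by
        rw [List.concat_eq_append, List.map_append] at hE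
        have := List.append_inj_right' hE rfl
        simpa using this
      subst he
      refine ⟨unfoldEdges Q' ++ R, ?_⟩
      simp [unfoldEdges, hR]

theorem exists_mem_rel_of_chain {α : Type*} {r : α → α → Prop} {ρ : Cycle α} (h : ρ.Chain r)
    {s : α} (hs : s ∈ ρ) : ∃ t ∈ ρ, r s t := by
  induction ρ using Quotient.inductionOn with
  | _ l =>
    obtain ⟨A, B, rfl⟩ := List.append_of_mem (Cycle.mem_coe_iff.1 hs)
    have he : ((A ++ s :: B : List α) : Cycle α) = ((s :: (B ++ A) : List α) : Cycle α) :=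
      Cycle.coe_eq_coe.2 List.isRotated_append
    change Cycle.Chain r ((A ++ s :: B : List α) : Cycle α) at h
    change ∃ t ∈ ((A ++ s :: B : List α) : Cycle α), r s t
    rw [he] at h ⊢
    rw [Cycle.chain_coe_cons] at h
    generalize B ++ A = D at h ⊢
    cases D with
    | nil => exact ⟨s, by simp, by simpa using h⟩
    | cons t D => exact ⟨t, by simp, (List.isChain_cons_cons.1 h).1⟩

/-- A pattern through `(a, e)` drops to `(0, e)`. -/
theorem zero_mem_of_mem_pairPrime {n a e : ℕ} {ρ : Cycle (ℕ × ℕ)} (h : ρ ∈ pairPrime n)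
    (hs : (a, e) ∈ ρ) : (0, e) ∈ ρ := by
  induction a with
  | zero => exact hs
  | succ a ih =>
    obtain ⟨⟨b, f⟩, ht, h1 | h1⟩ := exists_mem_rel_of_chain h.2.2 hs
    · simp only [Nat.add_right_cancel_iff] at h1
      obtain ⟨rfl, rfl⟩ := h1
      exact ih ht
    · simp at h1

theorem IsClosedWalk.coe_mem {z n : ℕ} {L : List (ℕ × ℕ)} (h : IsClosedWalk z n L) :
    (L : Cycle (ℕ × ℕ)) ∈ pairPrime n := by
  refine ⟨h.length_eq, h.nodup, ?_⟩
  obtain ⟨M, rfl⟩ := h.eq_concat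
  rw [Cycle.coe_eq_coe.2 (List.isRotated_concat _ _), Cycle.chain_coe_cons]
  exact h.isChain

theorem exists_isClosedWalk {z n : ℕ} {ρ : Cycle (ℕ × ℕ)} (h : ρ ∈ pairPrime n)
    (hz : (0, z) ∈ ρ) : ∃ L : List (ℕ × ℕ), (L : Cycle (ℕ × ℕ)) = ρ ∧ IsClosedWalk z n L := by
  induction ρ using Quotient.inductionOn with
  | _ l =>
    obtain ⟨A, B, rfl⟩ := List.append_of_mem (Cycle.mem_coe_iff.1 hz)
    have he : ((A ++ (0, z) :: B : List (ℕ × ℕ)) : Cycle (ℕ × ℕ)) =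
        (((0, z) :: (B ++ A) : List (ℕ × ℕ)) : Cycle (ℕ × ℕ)) :=
      Cycle.coe_eq_coe.2 List.isRotated_append
    have he2 : ((B ++ A ++ [(0, z)] : List (ℕ × ℕ)) : Cycle (ℕ × ℕ)) =
        (((0, z) :: (B ++ A) : List (ℕ × ℕ)) : Cycle (ℕ × ℕ)) :=
      Cycle.coe_eq_coe.2 (List.isRotated_concat _ _)
    change ((A ++ (0, z) :: B : List (ℕ × ℕ)) : Cycle (ℕ × ℕ)) ∈ pairPrime n at h
    refine ⟨B ++ A ++ [(0, z)], he2.trans he.symm, ?_⟩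
    have h3 := h.2.2
    rw [he, Cycle.chain_coe_cons] at h3
    rw [he, ← he2] at h
    exact ⟨h.1, h.2.1, h3, _, rfl⟩

/-- A cycle through distinct states has only one starting point at `(0, z)`. -/
theorem IsClosedWalk.eq_of_coe_eq {z n : ℕ} {L L' : List (ℕ × ℕ)} (h : IsClosedWalk z n L)
    (h' : IsClosedWalk z n L') (he : (L : Cycle (ℕ × ℕ)) = L') : L = L' := by
  obtain ⟨M, rfl⟩ := h.eq_concat
  obtain ⟨M', rfl⟩ := h'.eq_concat
  rw [Cycle.coe_eq_coe.2 (List.isRotated_concat _ _),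
    Cycle.coe_eq_coe.2 (List.isRotated_concat _ M'), Cycle.coe_eq_coe] at he
  have hnd : ((0, z) :: M).Nodup := (List.isRotated_concat _ _).nodup_iff.1 h.nodup
  obtain ⟨k, hk, hr⟩ := List.isRotated_iff_mod.1 he
  have hM : M = M' := by
    rcases Nat.lt_or_ge k ((0, z) :: M).length with hlt | hge
    · have h0 : (((0, z) :: M).rotate k)[0]? = some (0, z) := by rw [hr]; rfl
      rw [List.getElem?_rotate (by simp), Nat.zero_add, Nat.mod_eq_of_lt hlt] at h0
      have h1 : ((0, z) :: M)[k]? = ((0, z) :: M)[0]? := by rw [h0]; rfl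
      have := (List.getElem?_inj hlt hnd).1 h1
      subst this
      simpa using hr
    · obtain rfl : k = ((0, z) :: M).length := le_antisymm hk hge
      rw [List.rotate_length] at hr
      simpa using hr
  rw [hM]

/-- The pattern through `(0, 0)` given by a pair `(l, C)`: from `(0, 0)`, `l` beats lead to the
first vertex of the code `C`, or back to `(0, 0)` if `C` is empty. -/
def strictPattern (x : ℕ × List (List ℕ)) : Cycle (ℕ × ℕ) :=
  (unfoldEdges (codeEdges 0 x.1 x.2) : List (ℕ × ℕ))

/-- The pattern of a code, avoiding `(0, 0)`: it returns to the first vertex. -/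
def normalPattern (C : List (List ℕ)) : Cycle (ℕ × ℕ) :=
  (unfoldEdges (codeEdges (C.flatten.headD 0) 0 C) : List (ℕ × ℕ))

theorem isChain_codeEdges_zero {l : ℕ} (hl : 1 ≤ l) {C : List (List ℕ)} (hC : IsCode C) :
    List.IsChain EdgeRel ((0, 0) :: codeEdges 0 l C) := by
  have h1 := isChain_codeEdges 0 0 l hl hC
  obtain ⟨x, R, hx⟩ := exists_codeEdges_eq_cons 0 l hC.ne_nil
  rw [hx, List.isChain_cons_cons] at h1 ⊢
  exact ⟨⟨hl, Or.inl rfl⟩, h1.2⟩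

theorem isClosedWalk_zero {l n : ℕ} (hl : 1 ≤ l) {C : List (List ℕ)} (hC : IsCode C)
    (hn : l + topSum C = n) : IsClosedWalk 0 n (unfoldEdges (codeEdges 0 l C)) := by
  refine isClosedWalk_unfoldEdges (isChain_codeEdges_zero hl hC) (map_snd_codeEdges _ _ _) ?_ ?_
  · rw [← List.concat_eq_append, List.nodup_concat]
    exact ⟨hC.zero_notMem, hC.nodup⟩
  · rw [sum_fst_codeEdges _ _ hC, hn]

theorem image_strictPattern (n : ℕ) :
    strictPattern '' {x | 1 ≤ x.1 ∧ IsCode x.2 ∧ x.1 + topSum x.2 = n} =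
      {ρ ∈ pairPrime n | ∃ s ∈ ρ, s.2 = 0} := by
  ext ρ
  constructor
  · rintro ⟨⟨l, C⟩, ⟨hl, hC, hn⟩, rfl⟩
    have h := isClosedWalk_zero hl hC hn
    obtain ⟨M, hM⟩ := h.eq_concat
    exact ⟨h.coe_mem, (0, 0), Cycle.mem_coe_iff.2 (by rw [hM]; simp), rfl⟩
  · rintro ⟨hρ, ⟨a, e⟩, hs, rfl : e = 0⟩
    obtain ⟨L, rfl, hL⟩ := exists_isClosedWalk hρ (zero_mem_of_mem_pairPrime hρ hs)
    obtain ⟨Q, E, rfl, hc, hE, hnd, hsum⟩ := hL.exists_edges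
    have hpos := one_le_fst_of_isChain hc
    have h0 : 0 ∉ E := by
      rw [← List.concat_eq_append, List.nodup_concat] at hnd
      exact hnd.1
    obtain ⟨l, C, h1, h2, h3, rfl⟩ : ∃ l C, 1 ≤ l ∧ (∀ x ∈ C, x ≠ []) ∧
        (∀ x ∈ C, x.IsChain (· > ·)) ∧ Q = codeEdges 0 l C := by
      cases E with
      | nil =>
        obtain ⟨⟨k, e⟩, rfl, he⟩ := List.map_eq_singleton_iff.1 hE
        obtain rfl : e = 0 := he
        exact ⟨k, [], hpos (k, 0) (by simp), by simp, by simp, rfl⟩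
      | cons e E =>
        cases Q with
        | nil => simp at hE
        | cons q Q =>
          obtain ⟨k, e'⟩ := q
          simp only [List.map_cons, List.cons_append, List.cons.injEq] at hE
          obtain ⟨rfl, hE⟩ := hE
          obtain ⟨c, C, h3, h4, h5⟩ :=
            exists_codeEdges_eq (List.isChain_cons_cons.1 hc).2 hE h0 (Or.inl rfl)
          exact ⟨k, _, hpos (k, e') (by simp), h4, h5, h3⟩
    have hf : C.flatten = E := by
      rw [map_snd_codeEdges] at hE
      exact List.append_cancel_right hE
    have hC : IsCode C :=
      ⟨h2, h3, by rw [hf]; exact hnd.of_append_left, by rwa [hf]⟩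
    refine ⟨(l, C), ⟨h1, hC, ?_⟩, rfl⟩
    rw [← hsum, sum_fst_codeEdges _ _ hC]

theorem injOn_strictPattern (n : ℕ) :
    Set.InjOn strictPattern {x | 1 ≤ x.1 ∧ IsCode x.2 ∧ x.1 + topSum x.2 = n} := by
  rintro ⟨l, C⟩ ⟨hl, hC, hn⟩ ⟨l', C'⟩ ⟨hl', hC', hn'⟩ h
  have h1 := (isClosedWalk_zero hl hC hn).eq_of_coe_eq (isClosedWalk_zero hl' hC' hn') h
  have h2 := unfoldEdges_inj (one_le_fst_of_isChain (isChain_codeEdges_zero hl hC))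
    (one_le_fst_of_isChain (isChain_codeEdges_zero hl' hC')) h1
  obtain ⟨rfl, rfl⟩ := codeEdges_inj hC hC' h2
  rfl

/-- Codes starting with their largest entry, the normal forms of the patterns avoiding `(0, 0)`. -/
def IsHeadMax (C : List (List ℕ)) : Prop :=
  ∀ x ∈ C.flatten, x ≤ C.flatten.headD 0

/-- The first edge of `codeEdges d 0 C`, of length `0`, unfolds to nothing; the others form a closed
walk from the first vertex `d` to itself. -/
theorem exists_codeEdges_normal {n : ℕ} (hn : 1 ≤ n) {C : List (List ℕ)} (hC : IsCode C)
    (ht : topSum C = n) :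
    ∃ d F Q, C.flatten = d :: F ∧ codeEdges d 0 C = (0, d) :: Q ∧
      Q.map Prod.snd = F ++ [d] ∧ List.IsChain EdgeRel ((0, d) :: Q) ∧
      IsClosedWalk d n (unfoldEdges Q) := by
  cases C with
  | nil => simp [topSum] at ht; omega
  | cons c C =>
    cases c with
    | nil => exact absurd rfl (hC.ne_nil [] (by simp))
    | cons d c =>
      have hpos : 1 ≤ d := by
        have := hC.zero_notMem
        simp only [List.flatten_cons, List.mem_append, List.mem_cons, not_or] at this
        omega
      have hchain := isChain_codeEdges d 0 d hpos hC
      have hsnd := map_snd_codeEdges d 0 ((d :: c) :: C)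
      have hsum := sum_fst_codeEdges d 0 hC
      have hnd := hC.nodup
      obtain ⟨Q, hQ⟩ : ∃ Q, ∀ k, codeEdges d k ((d :: c) :: C) = (k, d) :: Q := by
        exact ⟨_, fun k => rfl⟩
      rw [hQ] at hchain hsnd hsum
      have hc2 : List.IsChain EdgeRel ((d, d) :: Q) := (List.isChain_cons_cons.1 hchain).2
      simp only [List.flatten_cons, List.cons_append, List.map_cons, List.cons.injEq,
        true_and] at hsnd hnd
      refine ⟨d, c ++ C.flatten, Q, rfl, hQ 0, hsnd, ?_, ?_⟩
      · cases Q with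
        | nil => simp
        | cons q Q =>
          rw [List.isChain_cons_cons] at hc2 ⊢
          exact hc2
      · refine isClosedWalk_unfoldEdges hc2 hsnd ?_ ?_
        · exact (List.isRotated_concat d (c ++ C.flatten)).nodup_iff.2 hnd
        · simpa [ht] using hsum

theorem image_normalPattern {n : ℕ} (hn : 1 ≤ n) :
    normalPattern '' {C | IsCode C ∧ topSum C = n ∧ IsHeadMax C} =
      {ρ ∈ pairPrime n | ∀ s ∈ ρ, s.2 ≠ 0} := by
  ext ρ
  constructor
  · rintro ⟨C, ⟨hC, ht, hm⟩, rfl⟩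
    obtain ⟨d, F, Q, hF, hQ, hsnd, hc, hw⟩ := exists_codeEdges_normal hn hC ht
    have he : normalPattern C = (unfoldEdges Q : List (ℕ × ℕ)) := by
      simp only [normalPattern, hF, List.headD_cons, hQ]
      rfl
    rw [he]
    refine ⟨hw.coe_mem, ?_⟩
    rintro ⟨a, e⟩ hs (rfl : e = 0)
    have h0 := Cycle.mem_coe_iff.1 (zero_mem_of_mem_pairPrime hw.coe_mem hs)
    rw [mem_unfoldEdges_zero (one_le_fst_of_isChain hc), hsnd] at h0
    refine hC.zero_notMem ?_
    rw [hF]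
    simpa [or_comm] using h0
  · rintro ⟨hρ, hne⟩
    -- the pattern is read from the state `(0, z)` with `z` as large as possible
    obtain ⟨z, hz, hmax⟩ : ∃ z, (0, z) ∈ ρ ∧ ∀ e, (0, e) ∈ ρ → e ≤ z := by
      have hfin : ∃ s, s ∈ ρ.toMultiset := by
        refine Multiset.card_pos_iff_exists_mem.1 ?_
        rw [Cycle.card_toMultiset, hρ.1]
        exact hn
      have hmem : ∀ s, s ∈ ρ.toMultiset ↔ s ∈ ρ := by
        intro s
        induction ρ using Quotient.inductionOn with | _ l => exact Iff.rfl
      obtain ⟨⟨a, e⟩, hs⟩ := hfin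
      have h0 := zero_mem_of_mem_pairPrime hρ ((hmem _).1 hs)
      have hfinite : {e | (0, e) ∈ ρ}.Finite := by
        refine ((ρ.toMultiset.map Prod.snd).toFinset.finite_toSet).subset ?_
        intro e he
        simpa using ⟨0, (hmem _).2 he⟩
      obtain ⟨z, hz, hz2⟩ := hfinite.exists_maximalFor id _ ⟨e, h0⟩
      exact ⟨z, hz, fun e he => le_of_not_gt fun hlt => absurd (hz2 he hlt.le) (not_le.2 hlt)⟩
    obtain ⟨L, rfl, hL⟩ := exists_isClosedWalk hρ hz
    obtain ⟨Q, E, rfl, hc, hE, hnd, hsum⟩ := hL.exists_edges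
    have hpos := one_le_fst_of_isChain hc
    have hmem : ∀ e, (0, e) ∈ ((unfoldEdges Q : List (ℕ × ℕ)) : Cycle (ℕ × ℕ)) ↔
        e ∈ z :: E := by
      intro e
      rw [Cycle.mem_coe_iff, mem_unfoldEdges_zero hpos, hE]
      simp [or_comm]
    have h0 : 0 ∉ z :: E := fun h => hne _ ((hmem 0).2 h) rfl
    obtain ⟨c, C, h3, h4, h5⟩ := exists_codeEdges_eq hc hE h0
      (Or.inr fun x hx => hmax x ((hmem x).2 hx))
    have hf : ((z :: c) :: C).flatten = z :: E := by
      have := congrArg (List.map Prod.snd) h3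
      rw [map_snd_codeEdges, List.map_cons, hE, ← List.cons_append] at this
      exact (List.append_cancel_right this).symm
    have hC : IsCode ((z :: c) :: C) := by
      refine ⟨h4, h5, ?_, by rwa [hf]⟩
      rw [hf]
      exact (List.isRotated_concat z E).nodup_iff.1 hnd
    refine ⟨(z :: c) :: C, ⟨hC, ?_, ?_⟩, ?_⟩
    · have := sum_fst_codeEdges z 0 hC
      rw [← h3] at this
      simpa [hsum] using this.symm
    · intro x hx
      rw [hf] at hx ⊢
      exact hmax x ((hmem x).2 hx)
    · rw [normalPattern, hf, List.headD_cons, ← h3]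
      rfl

theorem injOn_normalPattern {n : ℕ} (hn : 1 ≤ n) :
    Set.InjOn normalPattern {C | IsCode C ∧ topSum C = n ∧ IsHeadMax C} := by
  rintro C ⟨hC, ht, hm⟩ C' ⟨hC', ht', hm'⟩ h
  obtain ⟨d, F, Q, hF, hQ, hsnd, hc, hw⟩ := exists_codeEdges_normal hn hC ht
  obtain ⟨d', F', Q', hF', hQ', hsnd', hc', hw'⟩ := exists_codeEdges_normal hn hC' ht'
  rw [normalPattern, normalPattern, hF, hF', List.headD_cons, List.headD_cons, hQ, hQ'] at h
  change ((unfoldEdges Q : List (ℕ × ℕ)) : Cycle (ℕ × ℕ)) =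
    ((unfoldEdges Q' : List (ℕ × ℕ)) : Cycle (ℕ × ℕ)) at h
  have hmem : ∀ e, e ∈ d :: F ↔ e ∈ d' :: F' := by
    intro e
    have h1 : (0, e) ∈ ((unfoldEdges Q : List (ℕ × ℕ)) : Cycle (ℕ × ℕ)) ↔
        (0, e) ∈ ((unfoldEdges Q' : List (ℕ × ℕ)) : Cycle (ℕ × ℕ)) := by rw [h]
    rw [Cycle.mem_coe_iff, Cycle.mem_coe_iff, mem_unfoldEdges_zero (one_le_fst_of_isChain hc),
      mem_unfoldEdges_zero (one_le_fst_of_isChain hc'), hsnd, hsnd'] at h1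
    simpa [or_comm] using h1
  have hd : d = d' := by
    rw [IsHeadMax, hF] at hm
    rw [IsHeadMax, hF'] at hm'
    exact le_antisymm (hm' d ((hmem d).1 (by simp))) (hm d' ((hmem d').2 (by simp)))
  subst hd
  have h1 := hw.eq_of_coe_eq hw' h
  have h2 := unfoldEdges_inj (one_le_fst_of_isChain hc) (one_le_fst_of_isChain hc') h1
  exact (codeEdges_inj hC hC' (by rw [hQ, hQ', h2])).2

/-! ### Codes as families of disjoint sets -/

/-- The families of `t` pairwise disjoint nonempty finite sets of positive integers whose maxima
sum to `m`. -/
def blockFamilies (t m : ℕ) : Finset (Fin t → Finset ℕ) :=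
  (Fintype.piFinset fun _ => (Finset.Icc 1 m).powerset).filter fun s =>
    (∀ i, (s i).Nonempty) ∧ (∀ i j, i ≠ j → Disjoint (s i) (s j)) ∧ ∑ i, (s i).sup id = m

/-- The code whose chains are the sets of the family `s`, each listed in decreasing order. -/
def codeOf {t : ℕ} (s : Fin t → Finset ℕ) : List (List ℕ) :=
  List.ofFn fun i => (s i).sort (· ≥ ·)

theorem headD_sort (s : Finset ℕ) : (s.sort (· ≥ ·)).headD 0 = s.sup id := by
  have h1 := s.pairwise_sort (· ≥ ·)
  have h2 : ∀ x, x ∈ s.sort (· ≥ ·) ↔ x ∈ s := fun x => Finset.mem_sort _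
  generalize s.sort (· ≥ ·) = l at h1 h2
  cases l with
  | nil =>
    have : s = ∅ := Finset.eq_empty_of_forall_notMem fun x hx => by simpa using (h2 x).2 hx
    simp [this]
  | cons a l =>
    refine le_antisymm (Finset.le_sup (f := id) ((h2 a).1 (by simp))) (Finset.sup_le fun x hx => ?_)
    rcases List.mem_cons.1 ((h2 x).2 hx) with rfl | hx
    · simp
    · exact List.rel_of_pairwise_cons h1 hx

theorem mem_flatten_codeOf {t : ℕ} {s : Fin t → Finset ℕ} {x : ℕ} :
    x ∈ (codeOf s).flatten ↔ ∃ i, x ∈ s i := by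
  simp [codeOf, List.mem_flatten, List.mem_ofFn]

theorem topSum_codeOf {t : ℕ} (s : Fin t → Finset ℕ) :
    topSum (codeOf s) = ∑ i, (s i).sup id := by
  rw [topSum, codeOf, List.map_ofFn, List.sum_ofFn]
  simp only [Function.comp, headD_sort]

theorem codeOf_injective {t : ℕ} : Function.Injective (codeOf (t := t)) := by
  intro s s' h
  have h1 := List.ofFn_injective h
  funext i
  have := congrArg List.toFinset (congrFun h1 i)
  simpa using this

theorem isCode_codeOf {t m : ℕ} {s : Fin t → Finset ℕ} (h : s ∈ blockFamilies t m) :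
    IsCode (codeOf s) := by
  simp only [blockFamilies, Finset.mem_filter, Fintype.mem_piFinset, Finset.mem_powerset] at h
  obtain ⟨h1, h2, h3, -⟩ := h
  refine ⟨?_, ?_, ?_, ?_⟩
  · intro c hc
    obtain ⟨i, rfl⟩ := List.mem_ofFn.1 hc
    obtain ⟨x, hx⟩ := h2 i
    exact List.ne_nil_of_mem ((Finset.mem_sort _).2 hx)
  · intro c hc
    obtain ⟨i, rfl⟩ := List.mem_ofFn.1 hc
    exact (Finset.sortedGT_sort _).isChain
  · rw [List.nodup_flatten]
    constructor
    · intro c hc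
      obtain ⟨i, rfl⟩ := List.mem_ofFn.1 hc
      exact Finset.sort_nodup _ _
    · rw [codeOf, List.pairwise_ofFn]
      intro i j hij x hx hx'
      rw [Finset.mem_sort] at hx hx'
      exact Finset.disjoint_left.1 (h3 i j hij.ne) hx hx'
  · rw [mem_flatten_codeOf]
    rintro ⟨i, hi⟩
    simpa using h1 i hi

theorem IsCode.headD_pos {C : List (List ℕ)} (h : IsCode C) {c : List ℕ} (hc : c ∈ C) :
    1 ≤ c.headD 0 := by
  cases c with
  | nil => exact absurd rfl (h.ne_nil _ hc)
  | cons a c =>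
    have : a ≠ 0 := by
      rintro rfl
      exact h.zero_notMem (List.mem_flatten.2 ⟨_, hc, by simp⟩)
    simp only [List.headD_cons]
    omega

theorem IsCode.length_le {C : List (List ℕ)} (h : IsCode C) : C.length ≤ topSum C := by
  induction C with
  | nil => simp
  | cons c C ih =>
    have h1 := ih h.tail
    have h2 := h.headD_pos (c := c) (by simp)
    simp only [topSum, List.map_cons, List.sum_cons, List.length_cons] at h1 ⊢
    omega

theorem IsCode.exists_codeOf {C : List (List ℕ)} (h : IsCode C) :
    ∃ s ∈ blockFamilies C.length (topSum C), codeOf s = C := by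
  have hs : codeOf (fun i => (C.get i).toFinset) = C := by
    conv_rhs => rw [← List.ofFn_get C]
    unfold codeOf
    congr 1
    funext i
    have hc := (h.isChain _ (List.get_mem C i)).sortedGT
    exact (List.toFinset_sort _ hc.nodup).2 hc.sortedGE.pairwise
  refine ⟨_, ?_, hs⟩
  simp only [blockFamilies, Finset.mem_filter, Fintype.mem_piFinset, Finset.mem_powerset]
  have hsum := topSum_codeOf (fun i => (C.get i).toFinset)
  rw [hs] at hsum
  refine ⟨?_, ?_, ?_, hsum.symm⟩
  · intro i x hx
    rw [Finset.mem_Icc]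
    constructor
    · have hx0 : x ≠ 0 := by
        rintro rfl
        exact h.zero_notMem (List.mem_flatten.2 ⟨_, List.get_mem C i, List.mem_toFinset.1 hx⟩)
      omega
    · rw [hsum]
      refine le_trans (Finset.le_sup (f := id) hx) ?_
      exact Finset.single_le_sum (f := fun i => ((C.get i).toFinset).sup id)
        (fun _ _ => Nat.zero_le _) (Finset.mem_univ i)
  · intro i
    exact List.toFinset_nonempty_iff _ |>.2 (h.ne_nil _ (List.get_mem C i))
  · intro i j hij
    have hd := (List.nodup_flatten.1 h.nodup).2
    rw [List.pairwise_iff_get] at hd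
    rw [Finset.disjoint_left]
    intro x hx hx'
    rw [List.mem_toFinset] at hx hx'
    rcases lt_or_gt_of_ne hij with hlt | hlt
    · exact hd i j hlt hx hx'
    · exact hd j i hlt hx' hx

/-- The codes whose tops sum to `m`. -/
def codes (m : ℕ) : Finset (List (List ℕ)) :=
  ((Finset.range (m + 1)).sigma fun t => blockFamilies t m).image fun x => codeOf x.2

theorem topSum_of_mem {t m : ℕ} {s : Fin t → Finset ℕ} (h : s ∈ blockFamilies t m) :
    topSum (codeOf s) = m := by
  rw [topSum_codeOf]
  simp only [blockFamilies, Finset.mem_filter] at h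
  exact h.2.2.2

theorem mem_codes {m : ℕ} {C : List (List ℕ)} : C ∈ codes m ↔ IsCode C ∧ topSum C = m := by
  simp only [codes, Finset.mem_image, Finset.mem_sigma, Finset.mem_range]
  constructor
  · rintro ⟨⟨t, s⟩, ⟨-, hs⟩, rfl⟩
    exact ⟨isCode_codeOf hs, topSum_of_mem hs⟩
  · rintro ⟨h, rfl⟩
    obtain ⟨s, hs, he⟩ := h.exists_codeOf
    exact ⟨⟨_, s⟩, ⟨Nat.lt_succ_of_le h.length_le, hs⟩, he⟩

theorem codeOf_sigma_injective :
    Function.Injective fun x : (Σ t, Fin t → Finset ℕ) => codeOf x.2 := by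
  rintro ⟨t, s⟩ ⟨t', s'⟩ h
  have ht : t = t' := by simpa [codeOf] using congrArg List.length h
  subst ht
  obtain rfl : s = s' := codeOf_injective h
  rfl

theorem card_codes (m : ℕ) :
    (codes m).card = ∑ t ∈ Finset.range (m + 1), (blockFamilies t m).card := by
  rw [codes, Finset.card_image_of_injective _ codeOf_sigma_injective, Finset.card_sigma]

/-- The families whose first set contains the largest element of all. -/
def headMaxFamilies (t m : ℕ) : Finset (Fin (t + 1) → Finset ℕ) :=
  (blockFamilies (t + 1) m).filter fun s => ∀ i, (s i).sup id ≤ (s 0).sup id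

theorem isHeadMax_codeOf {t m : ℕ} {s : Fin (t + 1) → Finset ℕ}
    (h : s ∈ blockFamilies (t + 1) m) :
    IsHeadMax (codeOf s) ↔ ∀ i, (s i).sup id ≤ (s 0).sup id := by
  have h1 : (codeOf s).flatten.headD 0 = (s 0).sup id := by
    have h0 : ((s 0).sort (· ≥ ·)) ≠ [] := (isCode_codeOf h).ne_nil _ (by simp [codeOf])
    rw [← headD_sort]
    simp only [codeOf, List.ofFn_succ, List.flatten_cons]
    generalize (s 0).sort (· ≥ ·) = l at h0 ⊢
    cases l with
    | nil => exact absurd rfl h0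
    | cons a l => rfl
  simp only [IsHeadMax, h1, mem_flatten_codeOf, Finset.sup_le_iff (f := id), id]
  exact ⟨fun h i x hx => h x ⟨i, hx⟩, fun h x ⟨i, hx⟩ => h i x hx⟩

open Classical in
theorem card_filter_isHeadMax {m : ℕ} (hm : 1 ≤ m) :
    ((codes m).filter IsHeadMax).card = ∑ t ∈ Finset.range m, (headMaxFamilies t m).card := by
  rw [← Finset.card_sigma]
  symm
  refine Finset.card_bij (fun x _ => codeOf x.2) ?_ ?_ ?_
  · rintro ⟨t, s⟩ hs
    simp only [Finset.mem_sigma, headMaxFamilies, Finset.mem_filter] at hs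
    rw [Finset.mem_filter, mem_codes]
    exact ⟨⟨isCode_codeOf hs.2.1, topSum_of_mem hs.2.1⟩, (isHeadMax_codeOf hs.2.1).2 hs.2.2⟩
  · rintro ⟨t, s⟩ _ ⟨t', s'⟩ _ h
    have := @codeOf_sigma_injective ⟨t + 1, s⟩ ⟨t' + 1, s'⟩ h
    have ht : t = t' := by simpa using congrArg Sigma.fst this
    subst ht
    simpa using this
  · intro C hC
    rw [Finset.mem_filter, mem_codes] at hC
    obtain ⟨⟨h, rfl⟩, hmax⟩ := hC
    obtain ⟨s, hs, he⟩ := h.exists_codeOf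
    have hle := h.length_le
    generalize hk : C.length = k at s hs hle
    cases k with
    | zero =>
      obtain rfl := List.length_eq_zero_iff.1 hk
      simp [topSum] at hm
    | succ t =>
      refine ⟨⟨t, s⟩, ?_, he⟩
      simp only [Finset.mem_sigma, headMaxFamilies, Finset.mem_filter, Finset.mem_range]
      exact ⟨hle, hs, (isHeadMax_codeOf hs).1 (he ▸ hmax)⟩

/-! ### Counting families with given maxima -/

/-- The number of families of disjoint subsets of `{1, …, m}` with maxima `p`, as a product over
the choices for each `k`: a maximum lies in its own set, any other `k` lies in no set or in one
of those with a larger maximum. -/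
def blockWeight {t : ℕ} (p : Fin t → ℕ) (m : ℕ) : ℕ :=
  ∏ k ∈ Finset.Icc 1 m, if ∃ i, p i = k then 1 else 1 + (Finset.univ.filter fun i => k < p i).card

/-- The positive injective tuples with sum `m`. -/
def topTuples (t m : ℕ) : Finset (Fin t → ℕ) :=
  (Finset.finAntidiagonal t m).filter fun p => Function.Injective p ∧ ∀ i, 1 ≤ p i

/-- The possible positions of `k` in a family with maxima `p`: `some i` if `k` lies in the set
number `i`, `none` if it lies in no set. -/
def blockOptions {t : ℕ} (p : Fin t → ℕ) (k : ℕ) : Finset (Option (Fin t)) :=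
  if ∃ i, p i = k then (Finset.univ.filter fun i => p i = k).map Function.Embedding.some
  else Finset.insertNone (Finset.univ.filter fun i => k < p i)

theorem card_blockOptions {t : ℕ} {p : Fin t → ℕ} (hp : Function.Injective p) (k : ℕ) :
    (blockOptions p k).card =
      if ∃ i, p i = k then 1 else 1 + (Finset.univ.filter fun i => k < p i).card := by
  unfold blockOptions
  split_ifs with h
  · obtain ⟨i, hi⟩ := h
    rw [Finset.card_map, Finset.card_eq_one]
    refine ⟨i, ?_⟩
    ext j
    simp only [Finset.mem_filter, Finset.mem_univ, true_and, Finset.mem_singleton]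
    exact ⟨fun h => hp (h.trans hi.symm), fun h => h ▸ hi⟩
  · rw [Finset.card_insertNone, add_comm]

theorem some_mem_blockOptions {t : ℕ} {p : Fin t → ℕ} {k : ℕ} {i : Fin t} :
    some i ∈ blockOptions p k ↔ k ≤ p i ∧ ∀ j, p j = k → p i = k := by
  unfold blockOptions
  split_ifs with h
  · obtain ⟨j, hj⟩ := h
    simp only [Finset.mem_map, Finset.mem_filter, Finset.mem_univ, true_and,
      Function.Embedding.some_apply, Option.some.injEq, exists_eq_right]
    exact ⟨fun h => ⟨h.ge, fun _ _ => h⟩, fun h => h.2 j hj⟩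
  · simp only [Finset.some_mem_insertNone, Finset.mem_filter, Finset.mem_univ, true_and]
    constructor
    · exact fun h' => ⟨h'.le, fun j hj => absurd ⟨j, hj⟩ h⟩
    · exact fun h' => lt_of_le_of_ne h'.1 fun he => h ⟨i, he.symm⟩

theorem none_mem_blockOptions {t : ℕ} {p : Fin t → ℕ} {k : ℕ} :
    none ∈ blockOptions p k ↔ ∀ i, p i ≠ k := by
  unfold blockOptions
  split_ifs with h
  · simpa using h
  · simpa using h

/-- The families with prescribed maxima are counted by choosing a position for each `k`. -/
theorem card_filter_sup_eq {t m : ℕ} {p : Fin t → ℕ} (hp : p ∈ topTuples t m) :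
    ((blockFamilies t m).filter fun s => (fun i => (s i).sup id) = p).card = blockWeight p m := by
  simp only [topTuples, Finset.mem_filter, Finset.mem_finAntidiagonal] at hp
  obtain ⟨hsum, hinj, hpos⟩ := hp
  have hle : ∀ i, p i ≤ m := fun i => by
    rw [← hsum]
    exact Finset.single_le_sum (fun _ _ => Nat.zero_le _) (Finset.mem_univ i)
  have hcard : (Fintype.piFinset fun k : (Finset.Icc 1 m : Finset ℕ) => blockOptions p k).card =
      blockWeight p m := by
    rw [Fintype.card_piFinset, blockWeight, ← Finset.prod_coe_sort (Finset.Icc 1 m)]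
    exact Finset.prod_congr rfl fun k _ => card_blockOptions hinj _
  rw [← hcard]
  symm
  -- the family in which `k` lies in the set number `f k`, or in no set
  set S : ((Finset.Icc 1 m : Finset ℕ) → Option (Fin t)) → Fin t → Finset ℕ := fun f i =>
    (Finset.univ.filter fun k => f k = some i).map (Function.Embedding.subtype _) with hS
  have hmemS : ∀ f i x, x ∈ S f i ↔ ∃ h : x ∈ Finset.Icc 1 m, f ⟨x, h⟩ = some i := by
    intro f i x
    simp [hS]
  refine Finset.card_bij (fun f _ => S f) ?_ ?_ ?_
  · intro f hf
    rw [Fintype.mem_piFinset] at hf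
    have htop : ∀ i, p i ∈ S f i := by
      intro i
      rw [hmemS]
      refine ⟨Finset.mem_Icc.2 ⟨hpos i, hle i⟩, ?_⟩
      have h := hf ⟨p i, Finset.mem_Icc.2 ⟨hpos i, hle i⟩⟩
      cases hv : f ⟨p i, Finset.mem_Icc.2 ⟨hpos i, hle i⟩⟩ with
      | none =>
        rw [hv, none_mem_blockOptions] at h
        exact absurd rfl (h i)
      | some j =>
        rw [hv, some_mem_blockOptions] at h
        rw [hinj (h.2 i rfl)]
    have hsup : ∀ i, (S f i).sup id = p i := by
      intro i
      refine le_antisymm (Finset.sup_le fun x hx => ?_) (Finset.le_sup (f := id) (htop i))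
      obtain ⟨h, hx⟩ := (hmemS _ _ _).1 hx
      have := hf ⟨x, h⟩
      rw [hx, some_mem_blockOptions] at this
      exact this.1
    simp only [blockFamilies, Finset.mem_filter, Fintype.mem_piFinset, Finset.mem_powerset, hsup]
    refine ⟨⟨fun i x hx => ((hmemS _ _ _).1 hx).1, fun i => ⟨_, htop i⟩, ?_, hsum⟩, trivial⟩
    intro i j hij
    rw [Finset.disjoint_left]
    intro x hx hx'
    obtain ⟨h, hx⟩ := (hmemS _ _ _).1 hx
    obtain ⟨h', hx'⟩ := (hmemS _ _ _).1 hx'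
    exact hij (Option.some_injective _ (hx.symm.trans hx'))
  · intro f _ g _ hfg
    funext k
    refine Option.ext fun i => ?_
    have : (k : ℕ) ∈ S f i ↔ (k : ℕ) ∈ S g i := by rw [show S f = S g from hfg]
    rw [hmemS, hmemS] at this
    simpa [k.2] using this
  · intro s hs
    simp only [blockFamilies, Finset.mem_filter, Fintype.mem_piFinset, Finset.mem_powerset] at hs
    obtain ⟨⟨h1, h2, h3, -⟩, h5⟩ := hs
    classical
    set f : (Finset.Icc 1 m : Finset ℕ) → Option (Fin t) := fun k =>
      if h : ∃ i, (k : ℕ) ∈ s i then some h.choose else none with hf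
    have hfs : ∀ k i, f k = some i ↔ (k : ℕ) ∈ s i := by
      intro k i
      simp only [hf]
      constructor
      · intro h
        split_ifs at h with h'
        rw [← Option.some_injective _ h]
        exact h'.choose_spec
      · intro h
        have h' : ∃ i, (k : ℕ) ∈ s i := ⟨i, h⟩
        rw [dif_pos h']
        by_contra hne
        exact Finset.disjoint_left.1 (h3 _ _ fun he => hne (congrArg some he)) h'.choose_spec h
    have htop : ∀ i, p i ∈ s i := by
      intro i
      obtain ⟨x, hx, hx'⟩ := Finset.exists_mem_eq_sup (s i) (h2 i) id
      rw [← congrFun h5 i, hx']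
      exact hx
    refine ⟨f, ?_, ?_⟩
    · rw [Fintype.mem_piFinset]
      intro k
      cases hv : f k with
      | none =>
        rw [none_mem_blockOptions]
        intro i hi
        have := (hfs k i).2 (hi ▸ htop i)
        rw [hv] at this
        cases this
      | some i =>
        rw [some_mem_blockOptions]
        have hk := (hfs k i).1 hv
        refine ⟨?_, fun j hj => ?_⟩
        · rw [← congrFun h5 i]
          exact Finset.le_sup (f := id) hk
        · have := (hfs k j).2 (hj ▸ htop j)
          rw [hv] at this
          rw [Option.some_injective _ this, hj]
    · funext i
      ext x
      rw [hmemS]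
      constructor
      · rintro ⟨h, hx⟩
        exact (hfs _ _).1 hx
      · intro hx
        exact ⟨h1 i hx, (hfs ⟨x, h1 i hx⟩ i).2 hx⟩

theorem sup_mem_topTuples {t m : ℕ} {s : Fin t → Finset ℕ} (hs : s ∈ blockFamilies t m) :
    (fun i => (s i).sup id) ∈ topTuples t m := by
  simp only [blockFamilies, Finset.mem_filter, Fintype.mem_piFinset, Finset.mem_powerset] at hs
  obtain ⟨h1, h2, h3, h4⟩ := hs
  have hmem : ∀ i, (s i).sup id ∈ s i := by
    intro i
    obtain ⟨x, hx, hx'⟩ := Finset.exists_mem_eq_sup (s i) (h2 i) id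
    rw [hx']
    exact hx
  simp only [topTuples, Finset.mem_filter, Finset.mem_finAntidiagonal]
  refine ⟨h4, ?_, fun i => (Finset.mem_Icc.1 (h1 i (hmem i))).1⟩
  intro i j hij
  by_contra hne
  have hj := hmem j
  rw [← show (s i).sup id = (s j).sup id from hij] at hj
  exact Finset.disjoint_left.1 (h3 i j hne) (hmem i) hj

theorem card_blockFamilies_eq_sum (t m : ℕ) :
    (blockFamilies t m).card = ∑ p ∈ topTuples t m, blockWeight p m := by
  rw [Finset.card_eq_sum_card_fiberwise (f := fun s i => (s i).sup id)
    (t := topTuples t m) fun s hs => sup_mem_topTuples hs]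
  exact Finset.sum_congr rfl fun p hp => card_filter_sup_eq hp

theorem card_headMaxFamilies_eq_sum (t m : ℕ) :
    (headMaxFamilies t m).card =
      ∑ p ∈ (topTuples (t + 1) m).filter (fun p => ∀ i, p i ≤ p 0), blockWeight p m := by
  rw [Finset.card_eq_sum_card_fiberwise (f := fun s i => (s i).sup id)
    (t := (topTuples (t + 1) m).filter fun p => ∀ i, p i ≤ p 0)]
  · refine Finset.sum_congr rfl fun p hp => ?_
    rw [Finset.mem_filter] at hp
    rw [← card_filter_sup_eq hp.1, headMaxFamilies, Finset.filter_filter]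
    congr 1
    refine Finset.filter_congr fun s _ => ?_
    constructor
    · exact fun h => h.2
    · rintro rfl
      exact ⟨hp.2, rfl⟩
  · intro s hs
    rw [Finset.mem_coe, headMaxFamilies, Finset.mem_filter] at hs
    rw [Finset.mem_coe, Finset.mem_filter]
    exact ⟨sup_mem_topTuples hs.1, hs.2⟩

/-! ### Sorting the maxima -/

/-- The decreasing positive tuples with sum `m`. -/
def decTuples (t m : ℕ) : Finset (Fin t → ℕ) :=
  (Finset.finAntidiagonal t m).filter fun p => (∀ i j, i < j → p j < p i) ∧ ∀ i, 1 ≤ p i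

theorem blockWeight_comp_perm {t : ℕ} (p : Fin t → ℕ) (σ : Equiv.Perm (Fin t)) (m : ℕ) :
    blockWeight (p ∘ σ) m = blockWeight p m := by
  unfold blockWeight
  refine Finset.prod_congr rfl fun k _ => ?_
  have h1 : (∃ i, (p ∘ σ) i = k) ↔ ∃ i, p i = k :=
    ⟨fun ⟨i, hi⟩ => ⟨σ i, hi⟩, fun ⟨i, hi⟩ => ⟨σ.symm i, by simpa using hi⟩⟩
  have h2 : (Finset.univ.filter fun i => k < (p ∘ σ) i).card =
      (Finset.univ.filter fun i => k < p i).card :=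
    Finset.card_equiv σ (by simp)
  rw [h2]
  exact if_congr h1 rfl rfl

theorem exists_eq_comp_perm {t : ℕ} {p : Fin t → ℕ} (hp : Function.Injective p) :
    ∃ (q : Fin t → ℕ) (σ : Equiv.Perm (Fin t)), StrictAnti q ∧ q ∘ σ = p := by
  have h1 : StrictMono (p ∘ Tuple.sort p) :=
    (Tuple.monotone_sort p).strictMono_of_injective (hp.comp (Tuple.sort p).injective)
  refine ⟨p ∘ (Tuple.sort p) ∘ Fin.revPerm, (Tuple.sort p)⁻¹.trans Fin.revPerm, ?_, ?_⟩
  · exact h1.comp_strictAnti Fin.rev_strictAnti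
  · funext i
    simp

theorem strictAnti_comp_perm_inj {t : ℕ} {q q' : Fin t → ℕ} {σ σ' : Equiv.Perm (Fin t)}
    (hq : StrictAnti q) (hq' : StrictAnti q') (h : q ∘ σ = q' ∘ σ') : q = q' ∧ σ = σ' := by
  have hqq : q = q' := by
    apply List.ofFn_injective
    refine List.SortedGT.eq_of_mem_iff (List.sortedGT_ofFn_iff.2 hq)
      (List.sortedGT_ofFn_iff.2 hq') fun x => ?_
    rw [List.mem_ofFn, List.mem_ofFn]
    constructor
    · rintro ⟨i, rfl⟩
      exact ⟨σ' (σ.symm i), by simpa using (congrFun h (σ.symm i)).symm⟩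
    · rintro ⟨i, rfl⟩
      exact ⟨σ (σ'.symm i), by simpa using congrFun h (σ'.symm i)⟩
  subst hqq
  exact ⟨rfl, Equiv.ext fun i => hq.injective (congrFun h i)⟩

/-- Every injective tuple is a decreasing one composed with a unique permutation, and the weight
ignores the permutation. -/
theorem sum_topTuples_eq {t m : ℕ} (H : Finset (Equiv.Perm (Fin t)))
    (P : (Fin t → ℕ) → Prop) [DecidablePred P]
    (hP : ∀ (q : Fin t → ℕ) (σ : Equiv.Perm (Fin t)), StrictAnti q → (P (q ∘ σ) ↔ σ ∈ H)) :
    ∑ p ∈ (topTuples t m).filter P, blockWeight p m =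
      H.card * ∑ q ∈ decTuples t m, blockWeight q m := by
  have h1 : ∑ x ∈ H ×ˢ decTuples t m, blockWeight x.2 m =
      H.card * ∑ q ∈ decTuples t m, blockWeight q m := by
    rw [Finset.sum_product]
    simp only [Finset.sum_const, smul_eq_mul]
  rw [← h1]
  symm
  have hsum : ∀ (q : Fin t → ℕ) (σ : Equiv.Perm (Fin t)), ∑ i, (q ∘ σ) i = ∑ i, q i :=
    fun q σ => Equiv.sum_comp σ q
  refine Finset.sum_nbij (fun x => x.2 ∘ x.1) ?_ ?_ ?_ ?_
  · rintro ⟨σ, q⟩ hx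
    simp only [Finset.mem_product, decTuples, Finset.mem_filter,
      Finset.mem_finAntidiagonal] at hx
    obtain ⟨hσ, hq, hanti, hpos⟩ := hx
    have hanti : StrictAnti q := fun i j hij => hanti i j hij
    simp only [topTuples, Finset.mem_filter, Finset.mem_finAntidiagonal, hsum]
    exact ⟨⟨hq, hanti.injective.comp σ.injective, fun i => hpos _⟩, (hP q σ hanti).2 hσ⟩
  · rintro ⟨σ, q⟩ hx ⟨σ', q'⟩ hx' h
    simp only [Finset.coe_product, Set.mem_prod, Finset.mem_coe, decTuples,
      Finset.mem_filter] at hx hx'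
    obtain ⟨rfl, rfl⟩ := strictAnti_comp_perm_inj (fun i j hij => hx.2.2.1 i j hij)
      (fun i j hij => hx'.2.2.1 i j hij) h
    rfl
  · intro p hp
    simp only [Finset.mem_coe, topTuples, Finset.mem_filter, Finset.mem_finAntidiagonal] at hp
    obtain ⟨⟨h1, h2, h3⟩, h4⟩ := hp
    obtain ⟨q, σ, hq, rfl⟩ := exists_eq_comp_perm h2
    refine ⟨(σ, q), ?_, rfl⟩
    simp only [Finset.coe_product, Set.mem_prod, Finset.mem_coe, decTuples,
      Finset.mem_filter, Finset.mem_finAntidiagonal]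
    refine ⟨(hP q σ hq).1 h4, by rw [← h1, hsum], fun i j hij => hq hij, fun i => ?_⟩
    simpa using h3 (σ.symm i)
  · rintro ⟨σ, q⟩ _
    exact (blockWeight_comp_perm q σ m).symm

theorem card_perm_fix_zero (t : ℕ) :
    (Finset.univ.filter fun σ : Equiv.Perm (Fin (t + 1)) => σ 0 = 0).card = t.factorial := by
  have h : (Finset.univ : Finset (Equiv.Perm (Fin t))).card = t.factorial := by
    rw [Finset.card_univ, Fintype.card_perm, Fintype.card_fin]
  rw [← h]
  symm
  refine Finset.card_bij (fun e _ => Equiv.Perm.decomposeFin.symm (0, e)) ?_ ?_ ?_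
  · intro e _
    simp
  · intro e _ e' _ he
    simpa using Equiv.Perm.decomposeFin.symm.injective he
  · intro σ hσ
    obtain ⟨⟨a, e⟩, rfl⟩ := Equiv.Perm.decomposeFin.symm.surjective σ
    obtain rfl : a = 0 := by simpa using hσ
    exact ⟨e, Finset.mem_univ _, rfl⟩

theorem card_blockFamilies_eq (t m : ℕ) :
    (blockFamilies t m).card = t.factorial * ∑ q ∈ decTuples t m, blockWeight q m := by
  have h := sum_topTuples_eq (m := m) (Finset.univ : Finset (Equiv.Perm (Fin t)))
    (fun _ => True) (by simp)
  rw [Finset.filter_true, Finset.card_univ, Fintype.card_perm, Fintype.card_fin] at h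
  rw [card_blockFamilies_eq_sum, h]

theorem card_headMaxFamilies_eq (t m : ℕ) :
    (headMaxFamilies t m).card =
      t.factorial * ∑ q ∈ decTuples (t + 1) m, blockWeight q m := by
  rw [card_headMaxFamilies_eq_sum, ← card_perm_fix_zero]
  refine sum_topTuples_eq _ _ fun q σ hq => ?_
  simp only [Function.comp, Finset.mem_filter, Finset.mem_univ, true_and]
  constructor
  · intro h
    have := h (σ.symm 0)
    rw [Equiv.apply_symm_apply, hq.le_iff_ge] at this
    exact nonpos_iff_eq_zero.1 this
  · intro h i
    rw [h, hq.le_iff_ge]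
    exact Fin.zero_le _

/-! ### Evaluating the weight -/

/-- The product telescopes because a set closed under smaller indices is an initial segment. -/
theorem prod_filter_ratio (t : ℕ) (P : Fin t → Prop) [DecidablePred P]
    (hP : ∀ i j, i < j → P j → P i) :
    (∏ i : Fin t, if P i then (((i : ℕ) : ℚ) + 2) / (((i : ℕ) : ℚ) + 1) else 1) =
      1 + (Finset.univ.filter P).card := by
  induction t with
  | zero => simp
  | succ t ih =>
    have ih := ih (fun i => P i.castSucc) fun i j hij => hP _ _ (by simpa using hij)
    rw [Fin.prod_univ_castSucc, Finset.card_filter, Fin.sum_univ_castSucc, ← Finset.card_filter]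
    simp only [Fin.val_castSucc, ih, Fin.val_last]
    by_cases h : P (Fin.last t)
    · have hall : ∀ i : Fin t, P i.castSucc := fun i => hP _ _ (Fin.castSucc_lt_last i) h
      simp only [h, hall, Finset.filter_true, Finset.card_univ, Fintype.card_fin, if_true]
      have : (t : ℚ) + 1 ≠ 0 := by positivity
      push_cast
      field_simp
      ring
    · simp [h]

/-- The factors at the maxima themselves multiply to `t!`. -/
theorem factorial_mul_blockWeight {t m : ℕ} {q : Fin t → ℕ} (hq : StrictAnti q)
    (hpos : ∀ i, 1 ≤ q i) (hle : ∀ i, q i ≤ m) :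
    t.factorial * blockWeight q m =
      ∏ k ∈ Finset.Icc 1 m, (1 + (Finset.univ.filter fun i => k < q i).card) := by
  have hsub : Finset.univ.image q ⊆ Finset.Icc 1 m := by
    intro k hk
    obtain ⟨i, -, rfl⟩ := Finset.mem_image.1 hk
    exact Finset.mem_Icc.2 ⟨hpos i, hle i⟩
  have h1 : ∏ k ∈ Finset.univ.image q, (1 + (Finset.univ.filter fun i => k < q i).card) =
      t.factorial := by
    rw [Finset.prod_image fun i _ j _ h => hq.injective h]
    have : ∀ i : Fin t, 1 + (Finset.univ.filter fun j => q i < q j).card = (i : ℕ) + 1 := by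
      intro i
      simp only [hq.lt_iff_gt, Finset.filter_gt_eq_Iio, Fin.card_Iio]
      omega
    simp only [this]
    rw [← Finset.prod_range (fun i => i + 1), Finset.prod_range_add_one_eq_factorial]
  rw [← Finset.prod_sdiff hsub, h1, mul_comm]
  congr 1
  rw [blockWeight, ← Finset.prod_sdiff hsub]
  have h2 : ∏ k ∈ Finset.univ.image q, (if ∃ i, q i = k then 1 else
      1 + (Finset.univ.filter fun i => k < q i).card) = 1 := by
    refine Finset.prod_eq_one fun k hk => if_pos ?_
    simpa using hk
  rw [h2, mul_one]
  refine Finset.prod_congr rfl fun k hk => if_neg ?_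
  simpa using (Finset.mem_sdiff.1 hk).2

theorem factorial_mul_blockWeight_eq {t m : ℕ} {q : Fin t → ℕ} (hq : StrictAnti q)
    (hpos : ∀ i, 1 ≤ q i) (hle : ∀ i, q i ≤ m) :
    (t.factorial : ℚ) * blockWeight q m =
      1 / ((t : ℚ) + 1) *
        ∏ i : Fin t, ((((i : ℕ) : ℚ) + 2) / (((i : ℕ) : ℚ) + 1)) ^ q i := by
  have h1 := factorial_mul_blockWeight hq hpos hle
  have h2 : (t.factorial : ℚ) * blockWeight q m =
      ∏ k ∈ Finset.Icc 1 m, (1 + ((Finset.univ.filter fun i => k < q i).card : ℚ)) := by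
    exact_mod_cast h1
  have h3 : (t.factorial : ℚ) * blockWeight q m =
      ∏ i : Fin t, ((((i : ℕ) : ℚ) + 2) / (((i : ℕ) : ℚ) + 1)) ^ (q i - 1) := by
    rw [h2]
    simp_rw [← fun k => prod_filter_ratio t (fun i => k < q i)
      fun i j hij h => lt_trans h (hq hij)]
    rw [Finset.prod_comm]
    refine Finset.prod_congr rfl fun i _ => ?_
    rw [← Finset.prod_filter, Finset.prod_const]
    congr 1
    have : (Finset.Icc 1 m).filter (fun k => k < q i) = Finset.Ico 1 (q i) := by
      ext k
      have := hle i
      simp only [Finset.mem_filter, Finset.mem_Icc, Finset.mem_Ico]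
      omega
    rw [this, Nat.card_Ico]
  have h4 : ∏ i : Fin t, ((((i : ℕ) : ℚ) + 2) / (((i : ℕ) : ℚ) + 1)) = (t : ℚ) + 1 := by
    have := prod_filter_ratio t (fun _ => True) (by simp)
    simpa [add_comm] using this
  have h5 : ∏ i : Fin t, ((((i : ℕ) : ℚ) + 2) / (((i : ℕ) : ℚ) + 1)) ^ q i =
      (∏ i : Fin t, ((((i : ℕ) : ℚ) + 2) / (((i : ℕ) : ℚ) + 1)) ^ (q i - 1)) *
        ((t : ℚ) + 1) := by
    rw [← h4, ← Finset.prod_mul_distrib]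
    refine Finset.prod_congr rfl fun i _ => ?_
    rw [← pow_succ, Nat.sub_add_cancel (hpos i)]
  have h6 : (t : ℚ) + 1 ≠ 0 := by positivity
  rw [h5, h3]
  field_simp

theorem card_blockFamilies {t : ℕ} (ht : 1 ≤ t) (m : ℕ) :
    ((blockFamilies t m).card : ℚ) = t * spacingCount t m := by
  rw [card_blockFamilies_eq, spacingCount]
  push_cast
  rw [Finset.mul_sum, Finset.mul_sum]
  refine Finset.sum_congr rfl fun q hq => ?_
  simp only [Finset.mem_filter, Finset.mem_finAntidiagonal] at hq
  obtain ⟨hsum, hanti, hpos⟩ := hq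
  rw [factorial_mul_blockWeight_eq (fun i j hij => hanti i j hij) hpos fun i => by
    rw [← hsum]
    exact Finset.single_le_sum (fun _ _ => Nat.zero_le _) (Finset.mem_univ i)]
  have h1 : (t : ℚ) ≠ 0 := by positivity
  have h2 : (t : ℚ) + 1 ≠ 0 := by positivity
  field_simp

theorem card_headMaxFamilies (t m : ℕ) :
    ((headMaxFamilies t m).card : ℚ) = spacingCount (t + 1) m := by
  have h1 := card_blockFamilies (t := t + 1) (by omega) m
  rw [card_blockFamilies_eq, Nat.factorial_succ, mul_assoc, ← card_headMaxFamilies_eq] at h1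
  push_cast at h1
  exact mul_left_cancel₀ (by positivity) h1

/-! ### Summation -/

theorem spacingCount_eq_zero {t m : ℕ} (h : m < t) : spacingCount t m = 0 := by
  unfold spacingCount
  rw [Finset.filter_eq_empty_iff.2, Finset.sum_empty]
  rintro p hp ⟨-, hpos⟩
  have h1 : ∑ i : Fin t, 1 ≤ ∑ i, p i := Finset.sum_le_sum fun i _ => hpos i
  rw [Finset.mem_finAntidiagonal.1 hp] at h1
  simp at h1
  omega

theorem card_codes_eq {m n : ℕ} (hm : 1 ≤ m) (hmn : m ≤ n) :
    ((codes m).card : ℚ) = ∑ t ∈ Finset.Icc 1 n, (t : ℚ) * spacingCount t m := by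
  have h0 : blockFamilies 0 m = ∅ := by
    refine Finset.eq_empty_of_forall_notMem fun s hs => ?_
    have := topSum_of_mem hs
    simp [codeOf, topSum] at this
    omega
  rw [card_codes, Finset.sum_range_succ', h0, Finset.card_empty, add_zero]
  push_cast
  rw [Finset.sum_congr rfl fun t _ => card_blockFamilies (t := t + 1) (by omega) m,
    Finset.range_eq_Ico,
    Finset.sum_Ico_add' (fun t => ((t : ℕ) : ℚ) * spacingCount t m) 0 m 1]
  refine Finset.sum_subset (fun t ht => ?_) fun t ht hnot => ?_
  · rw [Finset.mem_Ico] at ht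
    exact Finset.mem_Icc.2 (by omega)
  · rw [Finset.mem_Ico] at hnot
    rw [Finset.mem_Icc] at ht
    rw [spacingCount_eq_zero (by omega), mul_zero]

theorem card_codes_zero : (codes 0).card = 1 := by
  rw [Finset.card_eq_one]
  refine ⟨[], ?_⟩
  ext C
  rw [mem_codes, Finset.mem_singleton]
  constructor
  · rintro ⟨h, h0⟩
    have := h.length_le
    exact List.length_eq_zero_iff.1 (by omega)
  · rintro rfl
    exact ⟨⟨by simp, by simp, by simp, by simp⟩, rfl⟩

open Classical in
theorem card_filter_isHeadMax_eq {n : ℕ} (hn : 1 ≤ n) :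
    (((codes n).filter IsHeadMax).card : ℚ) = ∑ t ∈ Finset.Icc 1 n, spacingCount t n := by
  rw [card_filter_isHeadMax hn]
  push_cast
  rw [Finset.range_eq_Ico, Finset.sum_congr rfl fun t _ => card_headMaxFamilies t n,
    Finset.sum_Ico_add' (fun t => spacingCount t n) 0 n 1]
  rfl

theorem finsum_pnat_eq {n : ℕ} {f : ℕ → ℚ} (hf : ∀ t, n < t → f t = 0) :
    (Function.support fun t : ℕ+ => f t).Finite ∧
      ∑ᶠ t : ℕ+, f t = ∑ t ∈ Finset.Icc 1 n, f t := by
  set S : Finset ℕ+ := (Finset.Icc 1 n).subtype (fun k => 0 < k) with hS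
  have hsub : (Function.support fun t : ℕ+ => f t) ⊆ S := by
    intro t ht
    have : (t : ℕ) ≤ n := by
      by_contra hlt
      exact ht (hf t (by omega))
    exact Finset.mem_subtype.2 (Finset.mem_Icc.2 ⟨t.pos, this⟩)
  refine ⟨S.finite_toSet.subset hsub, ?_⟩
  rw [finsum_eq_sum_of_support_subset _ hsub]
  refine Finset.sum_nbij (fun t : ℕ+ => (t : ℕ)) ?_ ?_ ?_ fun _ _ => rfl
  · intro t ht
    exact Finset.mem_subtype.1 ht
  · exact PNat.coe_injective.injOn
  · intro t ht
    have h1 := (Finset.mem_Icc.1 ht).1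
    exact ⟨⟨t, h1⟩, Finset.mem_subtype.2 ht, rfl⟩

/-- The pairs `(l, C)` that give the strict patterns of period `n`. -/
def strictCodes (n : ℕ) : Finset (ℕ × List (List ℕ)) :=
  (Finset.range n).biUnion fun m => (codes m).image fun C => (n - m, C)

theorem coe_strictCodes (n : ℕ) :
    (strictCodes n : Set (ℕ × List (List ℕ))) =
      {x | 1 ≤ x.1 ∧ IsCode x.2 ∧ x.1 + topSum x.2 = n} := by
  ext ⟨l, C⟩
  simp only [strictCodes, Finset.mem_coe, Finset.mem_biUnion, Finset.mem_range, Finset.mem_image,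
    mem_codes, Prod.mk.injEq, Set.mem_ofPred_eq]
  constructor
  · rintro ⟨m, hm, C, ⟨hC, rfl⟩, rfl, rfl⟩
    exact ⟨by omega, hC, by omega⟩
  · rintro ⟨h1, h2, h3⟩
    exact ⟨topSum C, by omega, C, ⟨h2, rfl⟩, by omega, rfl⟩

theorem card_strictCodes {n : ℕ} (hn : 1 ≤ n) :
    ((strictCodes n).card : ℚ) =
      (∑ t ∈ Finset.Icc 1 n, ∑ m ∈ Finset.Ico 1 n, (t : ℚ) * spacingCount t m) + 1 := by
  have h1 : (strictCodes n).card = ∑ m ∈ Finset.range n, (codes m).card := by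
    rw [strictCodes, Finset.card_biUnion]
    · refine Finset.sum_congr rfl fun m _ => Finset.card_image_of_injective _ fun C C' h => ?_
      simpa using h
    · intro m hm m' hm' hne
      rw [Function.onFun, Finset.disjoint_left]
      intro x hx hx'
      obtain ⟨C, -, rfl⟩ := Finset.mem_image.1 hx
      obtain ⟨C', -, h⟩ := Finset.mem_image.1 hx'
      simp only [Finset.coe_range, Set.mem_Iio, Prod.mk.injEq] at hm hm' h
      omega
  rw [h1, Finset.range_eq_Ico, Finset.sum_eq_sum_Ico_succ_bot (by omega), card_codes_zero,
    Finset.sum_comm, add_comm]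
  push_cast
  congr 1
  refine Finset.sum_congr rfl fun m hm => ?_
  rw [Finset.mem_Ico] at hm
  exact card_codes_eq (by omega) (by omega)

theorem strictMultiplexPrime_eq_image (n : ℕ) :
    strictMultiplexPrime n =
      Cycle.map pairState '' {ρ ∈ pairPrime n | ∃ s ∈ ρ, s.2 = 0} := by
  rw [strictMultiplexPrime, multiplexPrime_two_eq_image, normalPrime_two_eq_image,
    ← Set.image_sdiff (cycleMap_injective pairState_bijective.1)]
  congr 1
  ext ρ
  simp only [Set.mem_sdiff, Set.mem_ofPred_eq, not_and, not_forall, not_not]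
  constructor
  · rintro ⟨h1, h2⟩
    obtain ⟨s, hs, h⟩ := h2 h1
    exact ⟨h1, s, hs, h⟩
  · rintro ⟨h1, s, hs, h⟩
    exact ⟨h1, fun _ => ⟨s, hs, h⟩⟩

theorem ncard_strictMultiplexPrime (n : ℕ) :
    (strictMultiplexPrime n).Finite ∧ (strictMultiplexPrime n).ncard = (strictCodes n).card := by
  have hinj := cycleMap_injective pairState_bijective.1
  rw [strictMultiplexPrime_eq_image, ← image_strictPattern, ← coe_strictCodes]
  refine ⟨((Finset.finite_toSet _).image _).image _, ?_⟩
  have hon := injOn_strictPattern n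
  rw [← coe_strictCodes] at hon
  rw [Set.ncard_image_of_injective _ hinj, hon.ncard_image, Set.ncard_coe_finset]

open Classical in
theorem ncard_normalPrime {n : ℕ} (hn : 1 ≤ n) :
    (normalPrime 2 n).Finite ∧
      (normalPrime 2 n).ncard = ((codes n).filter IsHeadMax).card := by
  have hinj := cycleMap_injective pairState_bijective.1
  have hcoe : (((codes n).filter IsHeadMax : Finset (List (List ℕ))) : Set (List (List ℕ))) =
      {C | IsCode C ∧ topSum C = n ∧ IsHeadMax C} := by
    ext C
    simp only [Finset.mem_coe, Finset.mem_filter, mem_codes, Set.mem_ofPred_eq, and_assoc]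
  rw [normalPrime_two_eq_image, ← image_normalPattern hn, ← hcoe]
  refine ⟨((Finset.finite_toSet _).image _).image _, ?_⟩
  have hon := injOn_normalPattern hn
  rw [← hcoe] at hon
  rw [Set.ncard_image_of_injective _ hinj, hon.ncard_image, Set.ncard_coe_finset]

theorem mainTheorem3 (n : ℕ) (hn : 1 ≤ n) :
    (Function.support fun t : ℕ+ =>
        ∑ m ∈ Finset.Ico 1 n, ((t : ℕ) : ℚ) * spacingCount t m).Finite ∧
    (Function.support fun t : ℕ+ =>
        spacingCount t n + ∑ m ∈ Finset.Ico 1 n, ((t : ℕ) : ℚ) * spacingCount t m).Finite ∧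
    (strictMultiplexPrime n).Finite ∧
    ((strictMultiplexPrime n).ncard : ℚ) =
      (∑ᶠ t : ℕ+, ∑ m ∈ Finset.Ico 1 n, ((t : ℕ) : ℚ) * spacingCount t m) + 1 ∧
    (multiplexPrime 2 n 2).Finite ∧
    ((multiplexPrime 2 n 2).ncard : ℚ) =
      (∑ᶠ t : ℕ+, (spacingCount t n +
        ∑ m ∈ Finset.Ico 1 n, ((t : ℕ) : ℚ) * spacingCount t m)) + 1 := by
  classical
  have hzero : ∀ t, n < t → ∑ m ∈ Finset.Ico 1 n, (t : ℚ) * spacingCount t m = 0 := by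
    intro t ht
    refine Finset.sum_eq_zero fun m hm => ?_
    rw [Finset.mem_Ico] at hm
    rw [spacingCount_eq_zero (by omega), mul_zero]
  obtain ⟨hfin1, hsum1⟩ := finsum_pnat_eq hzero
  obtain ⟨hfin2, hsum2⟩ := finsum_pnat_eq (n := n)
    (f := fun t => spacingCount t n + ∑ m ∈ Finset.Ico 1 n, (t : ℚ) * spacingCount t m)
    fun t ht => by simp only [hzero t ht, spacingCount_eq_zero ht, add_zero]
  obtain ⟨hsf, hsc⟩ := ncard_strictMultiplexPrime n
  obtain ⟨hnf, hnc⟩ := ncard_normalPrime hn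
  have hsub : normalPrime 2 n ⊆ multiplexPrime 2 n 2 := by
    rw [normalPrime_two_eq_image, multiplexPrime_two_eq_image]
    exact Set.image_mono fun ρ h => h.1
  have hunion : multiplexPrime 2 n 2 = strictMultiplexPrime n ∪ normalPrime 2 n :=
    (Set.sdiff_union_of_subset hsub).symm
  have hdisj : Disjoint (strictMultiplexPrime n) (normalPrime 2 n) := Set.disjoint_sdiff_left
  refine ⟨hfin1, hfin2, hsf, ?_, ?_, ?_⟩
  · rw [hsum1, hsc, card_strictCodes hn]
  · rw [hunion]
    exact hsf.union hnf
  · rw [hsum2, hunion, Set.ncard_union_eq hdisj hsf hnf, hsc, hnc]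
    push_cast
    rw [card_strictCodes hn, card_filter_isHeadMax_eq hn, Finset.sum_add_distrib]
    ring
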